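/- Let $n\ge 1$ and let $\mathbb H^n=\mathbb C^n\times\mathbb R$ be the Heisenberg group, with points $(z,t)$, $z_j=x_j+iy_j$, product $(z,t)*(\zeta,\tau)=\big(z+\zeta,\;t+\tau+2\,\mathrm{Im}\sum_j z_j\bar\zeta_j\big)$ and horizontal left-invariant vector fields $X_j=\partial_{x_j}+2y_j\partial_t$, $Y_j=\partial_{y_j}-2x_j\partial_t$, $j=1,\dots,n$. For a Lebesgue measurable set $E\subset\mathbb H^n$ let $$P_H(E)=\sup\Big\{\int_E \sum_{j=1}^n (X_jV_j+Y_jV_{n+j})\,dz\,dt \;:\; V\in C^1_c(\mathbb H^n;\mathbb R^{2n}),\ \|V\|_\infty\le 1\Big\}\in[0,\infty]$$ be its $H$-perimeter, where $\|V\|_\infty$ is the supremum of the Euclidean norm of $V$. Put $\varphi(r)=\arccos r+r\sqrt{1-r^2}$ for $0\le r\le 1$, let $$E_{\mathrm{isop}}=\{(z,t)\in\mathbb H^n:\ |t|<\varphi(|z|),\ |z|<1\}$$ be Pansu's set, and for $0\le\varepsilon<1$ let $$C_\varepsilon=\{(z,t)\in\mathbb H^n:\ |z|<1,\ t>\varphi(1-\varepsilon)\}.$$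 Let $\mathcal L^{2n+1}$ be Lebesgue measure, let $\omega_{2n}$ be the Lebesgue measure of the Euclidean unit ball of $\mathbb R^{2n}$, and write $S\subset\subset U$ if the closure of $S$ is compact and contained in $U$. Then $P_H(E_{\mathrm{isop}})<\infty$, and for every Lebesgue measurable set $F\subset\mathbb H^n$ with $\mathcal L^{2n+1}(F)=\mathcal L^{2n+1}(E_{\mathrm{isop}})$ the following hold. (i) If $F\Delta E_{\mathrm{isop}}\subset\subset C_0$, then $$P_H(F)-P_H(E_{\mathrm{isop}})\ \ge\ \frac{n}{240\,\omega_{2n}^2}\,\mathcal L^{2n+1}(F\Delta E_{\mathrm{isop}})^3 .$$ (ii) If $0<\varepsilon<1$ and $F\Delta E_{\mathrm{isop}}\subset\subset C_\varepsilon$, then $$P_H(F)-P_H(E_{\mathrm{isop}})\ \ge\ \frac{n\sqrt{\varepsilon}}{16\,\omega_{2n}}\,\mathcal L^{2n+1}(F\Delta E_{\mathrm{isop}})^2 .$$ -/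

import Mathlib

open MeasureTheory

noncomputable section

/-- The manifold `ℂⁿ × ℝ` underlying the Heisenberg group, with points `(z, t)`. Its `volume` is the
Lebesgue measure of dimension `2n + 1`. (The group law
`(z, t) * (ζ, τ) = (z + ζ, t + τ + 2 Im ∑ zⱼ conj ζⱼ)` enters below only through its horizontal
left-invariant vector fields.) -/
abbrev Heisenberg (n : ℕ) : Type := (Fin n → ℂ) × ℝ

namespace Heisenberg

variable {n : ℕ}

/-- The Euclidean norm `|z|` of the horizontal coordinate of a point `(z, t)`. -/
def radius (p : Heisenberg n) : ℝ := Real.sqrt (∑ j, ‖p.1 j‖ ^ 2)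

/-- The left-invariant vector field `Xⱼ = ∂/∂xⱼ + 2 yⱼ ∂/∂t`, where `zⱼ = xⱼ + i yⱼ`. -/
def fieldX (j : Fin n) (p : Heisenberg n) : Heisenberg n :=
  (Pi.single j 1, 2 * (p.1 j).im)

/-- The left-invariant vector field `Yⱼ = ∂/∂yⱼ - 2 xⱼ ∂/∂t`, where `zⱼ = xⱼ + i yⱼ`. -/
def fieldY (j : Fin n) (p : Heisenberg n) : Heisenberg n :=
  (Pi.single j Complex.I, -2 * (p.1 j).re)

/-- The horizontal divergence `∑ⱼ Xⱼ Vⱼ + Yⱼ Vₙ₊ⱼ` of `V : ℍⁿ → ℝ²ⁿ`. The `2n` coordinates of `V`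
are indexed by `Fin n ⊕ Fin n`, with `Sum.inl j` for `j` and `Sum.inr j` for `n + j`. -/
def divH (V : Heisenberg n → EuclideanSpace ℝ (Fin n ⊕ Fin n)) (p : Heisenberg n) : ℝ :=
  ∑ j, (fderiv ℝ (fun q => V q (Sum.inl j)) p (fieldX j p) +
    fderiv ℝ (fun q => V q (Sum.inr j)) p (fieldY j p))

/-- The admissible test fields on an open set `A`: `V ∈ C¹_c(A; ℝ²ⁿ)`, extended by zero to `ℍⁿ`,
with `|V| ≤ 1` everywhere (Euclidean norm of `ℝ²ⁿ`). -/
def testFields (A : Set (Heisenberg n)) :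
    Set (Heisenberg n → EuclideanSpace ℝ (Fin n ⊕ Fin n)) :=
  {V | ContDiff ℝ 1 V ∧ HasCompactSupport V ∧ tsupport V ⊆ A ∧ ∀ p, ‖V p‖ ≤ 1}

/-- The `H`-perimeter of `E` in the open set `A`, with values in `[0, ∞]`. Since `V = 0` is
admissible, replacing each integral by its positive part leaves the supremum unchanged. -/
def perimeterIn (E A : Set (Heisenberg n)) : ENNReal :=
  ⨆ V ∈ testFields A, ENNReal.ofReal (∫ p in E, divH V p)

/-- The `H`-perimeter of `E` in the whole space. -/
def perimeter (E : Set (Heisenberg n)) : ENNReal := perimeterIn E Set.univ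

/-- The profile function `φ(r) = arccos r + r √(1 - r²)` (used for `0 ≤ r ≤ 1`). -/
def profile (r : ℝ) : ℝ := Real.arccos r + r * Real.sqrt (1 - r ^ 2)

/-- Pansu's set `{(z, t) : |t| < φ(|z|), |z| < 1}`. -/
def pansuSet (n : ℕ) : Set (Heisenberg n) :=
  {p | |p.2| < profile (radius p) ∧ radius p < 1}

/-- The half-cylinder `C_ε = {(z, t) : |z| < 1, t > φ(1 - ε)}`. -/
def halfCylinder (n : ℕ) (ε : ℝ) : Set (Heisenberg n) :=
  {p | radius p < 1 ∧ profile (1 - ε) < p.2}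

/-- `S ⊂⊂ U`: the closure of `S` is compact and contained in `U`. -/
def CompactlyContained (S U : Set (Heisenberg n)) : Prop :=
  IsCompact (closure S) ∧ closure S ⊆ U

/-- The Lebesgue measure of the Euclidean unit ball in `ℝᵏ`. -/
def unitBallVolume (k : ℕ) : ℝ :=
  (volume (Metric.ball (0 : EuclideanSpace ℝ (Fin k)) 1)).toReal

end Heisenberg

end

open MeasureTheory

noncomputable section

namespace Heisenberg

variable {n : ℕ}

/-! ### The squared horizontal radius and rotationally invariant horizontal fields -/

/-! The proof is a calibration argument. Let E be Pansu's set and let V be a horizontal field with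
|V| ≤ 1 whose flux through the boundary of E is its full horizontal area, with divergence 2n on F \
E and at most 2na on E \ F, where a ≤ 1. The sets F \ E and E \ F have equal volume, so testing the
perimeter of F with V gives P_H(F) ≥ P_H(E) + 2n ∫_{E \ F} (1 - a). A pointwise bound 1 - a ≥ q
(φ(|z|) - t)^d and the rearrangement inequality `bathtub` turn this integral into a multiple of the
(d + 1)-st power of the volume of the symmetric difference.

The field is V = a z - i B z with B = sign(t) √(1 - |z|² a²) / |z|, so |V| = 1. Above E one takes a
= 1, which corresponds to vertical translates of the upper hemisphere. Inside E, put P = φ(|z|) and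
c = φ(1 - ε); the level sets of a are the explicit leaves t = c + √(P² + 4U) - √(c² + 4U) with U =
a⁻² - 1, and solving for U gives `leafParam`. These leaves do not have constant curvature, but they
are less steep than the surfaces that do (`slope_comparison`, which rests on `sqProfile_le`), and
this is the sign needed for div V ≤ 2na (`IsUncut.divH_inside`). The bound U ≥ (P - t)(P - t + 2c) /
4 of `le_leafParam` is quadratic in the depth for every c ≥ 0 and linear once c > 0; hence the
exponents 3 and 2.

V is neither C¹ nor compactly supported, so it is regularised by cutoffs and a parameter δ. On the
compact closure of the symmetric difference all cutoffs are inactive and the errors are O(δ). The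
exact perimeter of E is never needed: Gauss–Green on smoothed hemispheres bounds it above by twice
the integral of `areaDensity` (`perimeter_pansuSet_le`), and the fluxes of the regularised fields
converge to the same number (`tendsto_integral_fluxDensity`). -/

/-- The squared Euclidean norm on `ℂⁿ`. -/
def sqNorm (z : Fin n → ℂ) : ℝ := ∑ j, ‖z j‖ ^ 2

/-- The derivative of `sqNorm`. -/
def sqNormDeriv (z : Fin n → ℂ) : (Fin n → ℂ) →L[ℝ] ℝ :=
  ∑ j, ((2 * (z j).re) • Complex.reCLM.comp (ContinuousLinearMap.proj (R := ℝ) (φ := fun _ => ℂ) j) +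
    (2 * (z j).im) • Complex.imCLM.comp (ContinuousLinearMap.proj (R := ℝ) (φ := fun _ => ℂ) j))

lemma sqNorm_eq (z : Fin n → ℂ) : sqNorm z = ∑ j, ((z j).re ^ 2 + (z j).im ^ 2) := by
  refine Finset.sum_congr rfl fun j _ => ?_
  rw [Complex.sq_norm, Complex.normSq_apply]; ring

lemma sqNorm_nonneg (z : Fin n → ℂ) : 0 ≤ sqNorm z := Finset.sum_nonneg fun _ _ => by positivity

lemma radius_eq (p : Heisenberg n) : radius p = √(sqNorm p.1) := rfl

lemma sqNormDeriv_apply (z v : Fin n → ℂ) :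
    sqNormDeriv z v = ∑ j, 2 * ((z j).re * (v j).re + (z j).im * (v j).im) := by
  simp only [sqNormDeriv, _root_.sum_apply]
  refine Finset.sum_congr rfl fun j _ => ?_
  simp
  ring

lemma hasFDerivAt_sqNorm (z : Fin n → ℂ) : HasFDerivAt sqNorm (sqNormDeriv z) z := by
  have h : (sqNorm : (Fin n → ℂ) → ℝ) = fun z => ∑ j, ((z j).re ^ 2 + (z j).im ^ 2) :=
    funext sqNorm_eq
  rw [h]
  refine HasFDerivAt.fun_sum fun j _ => ?_
  have hp : HasFDerivAt (fun z : Fin n → ℂ => z j)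
      (ContinuousLinearMap.proj (R := ℝ) (φ := fun _ => ℂ) j) z := hasFDerivAt_apply j z
  have hre := (Complex.reCLM.hasFDerivAt.comp z hp).pow 2
  have him := (Complex.imCLM.hasFDerivAt.comp z hp).pow 2
  convert! hre.add him using 1
  ext v
  simp

lemma contDiff_sqNorm : ContDiff ℝ 1 (sqNorm : (Fin n → ℂ) → ℝ) := by
  have h : (sqNorm : (Fin n → ℂ) → ℝ) = fun z => ∑ j, ((z j).re ^ 2 + (z j).im ^ 2) :=
    funext sqNorm_eq
  rw [h]
  refine ContDiff.sum fun j _ => ?_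
  have hp : ContDiff ℝ 1 (fun z : Fin n → ℂ => z j) := contDiff_apply ℝ ℂ j
  exact ((Complex.reCLM.contDiff.comp hp).pow 2).add ((Complex.imCLM.contDiff.comp hp).pow 2)

lemma continuous_sqNorm : Continuous (sqNorm : (Fin n → ℂ) → ℝ) := contDiff_sqNorm.continuous

lemma sqNormDeriv_self (z : Fin n → ℂ) : sqNormDeriv z z = 2 * sqNorm z := by
  rw [sqNormDeriv_apply, sqNorm_eq, Finset.mul_sum]
  exact Finset.sum_congr rfl fun j _ => by ring

lemma sqNormDeriv_rotate (z : Fin n → ℂ) : sqNormDeriv z (fun j => -Complex.I * z j) = 0 := by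
  rw [sqNormDeriv_apply]
  exact Finset.sum_eq_zero fun j _ => by simp; ring

lemma sqNormDeriv_single_one (z : Fin n → ℂ) (j : Fin n) :
    sqNormDeriv z (Pi.single j 1) = 2 * (z j).re := by
  rw [sqNormDeriv_apply, Finset.sum_eq_single j]
  · simp
  · intro i _ hi; simp [Pi.single_eq_of_ne hi]
  · simp

lemma sqNormDeriv_single_I (z : Fin n → ℂ) (j : Fin n) :
    sqNormDeriv z (Pi.single j Complex.I) = 2 * (z j).im := by
  rw [sqNormDeriv_apply, Finset.sum_eq_single j]
  · simp
  · intro i _ hi; simp [Pi.single_eq_of_ne hi]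
  · simp

lemma norm_sq_horizontal (V : EuclideanSpace ℝ (Fin n ⊕ Fin n)) :
    ‖V‖ ^ 2 = ∑ j, (V (Sum.inl j) ^ 2 + V (Sum.inr j) ^ 2) := by
  rw [EuclideanSpace.norm_sq_eq, Fintype.sum_sum_type, Finset.sum_add_distrib]
  simp

/-- The horizontal field `A z - i B z`. -/
def radialField (A B : Heisenberg n → ℝ) (p : Heisenberg n) : EuclideanSpace ℝ (Fin n ⊕ Fin n) :=
  WithLp.toLp 2 (Sum.elim (fun j => A p * (p.1 j).re + B p * (p.1 j).im)
    (fun j => A p * (p.1 j).im - B p * (p.1 j).re))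

/-- The vectors z and -iz are orthogonal and of equal length, so the mixed terms cancel. Away from z
= 0, the choice B² = (1 - |z|² A²) / |z|² yields a unit field. -/
lemma norm_sq_radialField (A B : Heisenberg n → ℝ) (p : Heisenberg n) :
    ‖radialField A B p‖ ^ 2 = sqNorm p.1 * (A p ^ 2 + B p ^ 2) := by
  rw [norm_sq_horizontal, sqNorm_eq, Finset.sum_mul]
  refine Finset.sum_congr rfl fun j _ => ?_
  simp [radialField]
  ring

lemma contDiff_radialField {A B : Heisenberg n → ℝ} (hA : ContDiff ℝ 1 A) (hB : ContDiff ℝ 1 B) :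
    ContDiff ℝ 1 (radialField A B) := by
  rw [contDiff_euclidean]
  have hz : ∀ j, ContDiff ℝ 1 (fun p : Heisenberg n => p.1 j) := fun j =>
    (contDiff_apply ℝ ℂ j).comp contDiff_fst
  have hre : ∀ j, ContDiff ℝ 1 (fun p : Heisenberg n => (p.1 j).re) := fun j =>
    Complex.reCLM.contDiff.comp (hz j)
  have him : ∀ j, ContDiff ℝ 1 (fun p : Heisenberg n => (p.1 j).im) := fun j =>
    Complex.imCLM.contDiff.comp (hz j)
  rintro (j | j)
  · exact (hA.mul (hre j)).add (hB.mul (him j))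
  · exact (hA.mul (him j)).sub (hB.mul (hre j))

/-- The frame recombines as ∑ (xⱼXⱼ + yⱼYⱼ) = (z, 0) and ∑ (yⱼXⱼ - xⱼYⱼ) = (-iz, 2|z|²), so A and B
are each differentiated in one direction only. The second direction is tangent to the cylinders |z|
= const. -/
lemma divH_radialField {A B : Heisenberg n → ℝ} {p : Heisenberg n} (hA : DifferentiableAt ℝ A p)
    (hB : DifferentiableAt ℝ B p) :
    divH (radialField A B) p = 2 * n * A p + fderiv ℝ A p (p.1, 0) +
      fderiv ℝ B p (fun j => -Complex.I * p.1 j, 2 * sqNorm p.1) := by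
  have hz : ∀ j, HasFDerivAt (fun p : Heisenberg n => p.1 j)
      ((ContinuousLinearMap.proj (R := ℝ) (φ := fun _ => ℂ) j).comp
        (ContinuousLinearMap.fst ℝ (Fin n → ℂ) ℝ)) p := fun j =>
    ((ContinuousLinearMap.proj (R := ℝ) (φ := fun _ => ℂ) j).comp
      (ContinuousLinearMap.fst ℝ (Fin n → ℂ) ℝ)).hasFDerivAt
  have hre : ∀ j, HasFDerivAt (fun p : Heisenberg n => (p.1 j).re) _ p := fun j =>
    Complex.reCLM.hasFDerivAt.comp p (hz j)
  have him : ∀ j, HasFDerivAt (fun p : Heisenberg n => (p.1 j).im) _ p := fun j =>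
    Complex.imCLM.hasFDerivAt.comp p (hz j)
  have h1 : ∀ j, fderiv ℝ (fun q => radialField A B q (Sum.inl j)) p (fieldX j p) =
      A p + (p.1 j).re * fderiv ℝ A p (fieldX j p) + (p.1 j).im * fderiv ℝ B p (fieldX j p) := by
    intro j
    have h := (hA.hasFDerivAt.mul (hre j)).add (hB.hasFDerivAt.mul (him j))
    have h' := h.fderiv
    change fderiv ℝ (fun q : Heisenberg n => A q * (q.1 j).re + B q * (q.1 j).im) p _ = _
    change fderiv ℝ (fun q : Heisenberg n => A q * (q.1 j).re + B q * (q.1 j).im) p = _ at h'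
    rw [h']
    simp [fieldX]
  have h2 : ∀ j, fderiv ℝ (fun q => radialField A B q (Sum.inr j)) p (fieldY j p) =
      A p + (p.1 j).im * fderiv ℝ A p (fieldY j p) - (p.1 j).re * fderiv ℝ B p (fieldY j p) := by
    intro j
    have h := (hA.hasFDerivAt.mul (him j)).sub (hB.hasFDerivAt.mul (hre j))
    have h' := h.fderiv
    change fderiv ℝ (fun q : Heisenberg n => A q * (q.1 j).im - B q * (q.1 j).re) p _ = _
    change fderiv ℝ (fun q : Heisenberg n => A q * (q.1 j).im - B q * (q.1 j).re) p = _ at h'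
    rw [h']
    simp [fieldY]
  have e1 : ((p.1, 0) : Heisenberg n) =
      ∑ j, ((p.1 j).re • fieldX j p + (p.1 j).im • fieldY j p) := by
    refine Prod.ext ?_ ?_
    · ext i
      simp only [Prod.fst_sum, Prod.fst_add, Prod.smul_fst, fieldX, fieldY, Finset.sum_apply,
        Pi.add_apply, Pi.smul_apply]
      rw [Finset.sum_eq_single i]
      · simp [Complex.re_add_im]
      · intro j _ hj; simp [Pi.single_eq_of_ne' hj]
      · simp
    · simp only [Prod.snd_sum, Prod.snd_add, Prod.smul_snd, fieldX, fieldY, smul_eq_mul]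
      exact (Finset.sum_eq_zero fun j _ => by ring).symm
  have e2 : ((fun j => -Complex.I * p.1 j, 2 * sqNorm p.1) : Heisenberg n) =
      ∑ j, ((p.1 j).im • fieldX j p - (p.1 j).re • fieldY j p) := by
    refine Prod.ext ?_ ?_
    · ext i
      simp only [Prod.fst_sum, Prod.fst_sub, Prod.smul_fst, fieldX, fieldY, Finset.sum_apply,
        Pi.sub_apply, Pi.smul_apply]
      rw [Finset.sum_eq_single i]
      · apply Complex.ext <;> simp
      · intro j _ hj; simp [Pi.single_eq_of_ne' hj]
      · simp
    · simp only [Prod.snd_sum, Prod.snd_sub, Prod.smul_snd, fieldX, fieldY, smul_eq_mul]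
      rw [sqNorm_eq, Finset.mul_sum]
      exact Finset.sum_congr rfl fun j _ => by ring
  rw [e1, e2, divH, map_sum, map_sum]
  simp only [h1, h2, map_add, map_sub, map_smul, smul_eq_mul]
  have : 2 * n * A p = ∑ _j : Fin n, 2 * A p := by simp; ring
  rw [this, ← Finset.sum_add_distrib, ← Finset.sum_add_distrib]
  exact Finset.sum_congr rfl fun j _ => by ring

/-! ### The profile as a function of the squared radius -/

/-- The profile as a function of the squared radius. -/
def sqProfile (x : ℝ) : ℝ := profile √x

lemma sqProfile_eq (x : ℝ) (hx : 0 ≤ x) : sqProfile x = Real.arccos √x + √x * √(1 - x) := by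
  rw [sqProfile, profile, Real.sq_sqrt hx]

lemma continuous_sqProfile : Continuous sqProfile := by
  unfold sqProfile profile
  fun_prop

lemma sqProfile_of_nonpos {x : ℝ} (hx : x ≤ 0) : sqProfile x = Real.pi / 2 := by
  simp [sqProfile, profile, Real.sqrt_eq_zero_of_nonpos hx]

lemma sqProfile_of_one_le {x : ℝ} (hx : 1 ≤ x) : sqProfile x = 0 := by
  rw [sqProfile_eq x (by linarith), Real.arccos_eq_zero.2 (Real.one_le_sqrt.2 hx),
    Real.sqrt_eq_zero_of_nonpos (by linarith : 1 - x ≤ 0)]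
  simp

lemma sqProfile_nonneg (x : ℝ) : 0 ≤ sqProfile x :=
  add_nonneg (Real.arccos_nonneg _) (mul_nonneg (Real.sqrt_nonneg _) (Real.sqrt_nonneg _))

lemma sqProfile_pos_iff {x : ℝ} : 0 < sqProfile x ↔ x < 1 := by
  refine ⟨fun h => not_le.1 fun hx => h.ne' (sqProfile_of_one_le hx), fun h => ?_⟩
  refine add_pos_of_pos_of_nonneg (Real.arccos_pos.2 ?_)
    (mul_nonneg (Real.sqrt_nonneg _) (Real.sqrt_nonneg _))
  rw [Real.sqrt_lt' one_pos]; simpa using h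

/-- In the variable x = r² the derivative is continuous across x = 0 (the profile is constant for x
≤ 0), so the axis z = 0 causes no singularity. At 0 the two one-sided derivatives are glued. -/
lemma hasDerivAt_sqProfile {x : ℝ} (hx : x < 1) : HasDerivAt sqProfile (-√x / √(1 - x)) x := by
  have hpos : ∀ y, 0 < y → y < 1 → HasDerivAt sqProfile (-√y / √(1 - y)) y := by
    intro y h0 h1
    have hs : 0 < √y := Real.sqrt_pos.2 h0
    have hs1 : √y < 1 := by rw [Real.sqrt_lt' one_pos]; simpa using h1
    have hw : 0 < √(1 - y) := Real.sqrt_pos.2 (by linarith)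
    have ha := (Real.hasDerivAt_arccos (by linarith : √y ≠ -1) hs1.ne).comp y
      (Real.hasDerivAt_sqrt h0.ne')
    have hb := (Real.hasDerivAt_sqrt h0.ne').mul
      (((hasDerivAt_id y).const_sub 1).sqrt (by simp; linarith))
    have h := ha.add hb
    have heq : sqProfile =ᶠ[nhds y] fun x => Real.arccos √x + √x * √(1 - x) := by
      filter_upwards [lt_mem_nhds h0] with u hu using sqProfile_eq u hu.le
    refine (h.congr_of_eventuallyEq heq).congr_deriv ?_
    simp only [id, Real.sq_sqrt h0.le]
    have e1 : √y ^ 2 = y := Real.sq_sqrt h0.le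
    have e2 : √(1 - y) ^ 2 = 1 - y := Real.sq_sqrt (by linarith)
    field_simp
    linear_combination e1 + e2
  have hneg : ∀ y, y < 0 → HasDerivAt sqProfile (-√y / √(1 - y)) y := by
    intro y hy
    rw [Real.sqrt_eq_zero_of_nonpos hy.le]
    have heq : sqProfile =ᶠ[nhds y] fun _ => Real.pi / 2 := by
      filter_upwards [gt_mem_nhds hy] with u hu using sqProfile_of_nonpos hu.le
    simpa using (hasDerivAt_const y (Real.pi / 2)).congr_of_eventuallyEq heq
  rcases lt_trichotomy x 0 with h | h | h
  · exact hneg x h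
  · subst h
    have hg : ContinuousAt (fun y : ℝ => -√y / √(1 - y)) 0 := by
      refine ContinuousAt.div (by fun_prop) (by fun_prop) ?_
      simp
    have hr : HasDerivWithinAt sqProfile (-√0 / √(1 - 0)) (Set.Ici 0) 0 := by
      refine hasDerivWithinAt_Ici_of_tendsto_deriv (s := Set.Ioo 0 1)
        (fun y hy => (hpos y hy.1 hy.2).differentiableAt.differentiableWithinAt)
        continuous_sqProfile.continuousWithinAt (Ioo_mem_nhdsGT one_pos) ?_
      refine (Filter.tendsto_inf_left hg).congr' ?_
      filter_upwards [Ioo_mem_nhdsGT one_pos] with y hy using (hpos y hy.1 hy.2).deriv.symm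
    have hl : HasDerivWithinAt sqProfile (-√0 / √(1 - 0)) (Set.Iic 0) 0 := by
      have := (hasDerivWithinAt_const (0 : ℝ) (Set.Iic (0 : ℝ)) (Real.pi / 2)).congr
        (f₁ := sqProfile) (fun y hy => sqProfile_of_nonpos hy) (sqProfile_of_nonpos le_rfl)
      simpa using this
    simpa using hl.union hr
  · exact hpos x h hx

lemma contDiffAt_sqProfile {x : ℝ} (hx : x < 1) : ContDiffAt ℝ 1 sqProfile x := by
  rw [contDiffAt_one_iff]
  refine ⟨fun y => ContinuousLinearMap.toSpanSingleton ℝ (-√y / √(1 - y)), Set.Iio 1,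
    Iio_mem_nhds hx, ?_, fun y hy => (hasDerivAt_sqProfile hy).hasFDerivAt⟩
  have : ContinuousOn (fun y : ℝ => -√y / √(1 - y)) (Set.Iio 1) := by
    refine ContinuousOn.div (by fun_prop) (by fun_prop) fun y hy => ?_
    have : (0:ℝ) < 1 - y := by simpa using hy
    exact (Real.sqrt_pos.2 this).ne'
  exact (ContinuousLinearMap.toSpanSingletonCLE (𝕜 := ℝ) (E := ℝ)).continuous.comp_continuousOn this

/-- Both sides vanish at 1, and their difference has derivative (√x - 1) / √(1 - x) ≤ 0. The
constant 2 is matched to the factor 1/4 in `leafParam`. -/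
lemma sqProfile_le {x : ℝ} (hx : 0 ≤ x) : sqProfile x ≤ 2 * √(1 - x) := by
  rcases le_total 1 x with h | h
  · rw [sqProfile_of_one_le h]; positivity
  have hanti : AntitoneOn (fun x => 2 * √(1 - x) - sqProfile x) (Set.Icc 0 1) := by
    refine antitoneOn_of_deriv_nonpos (convex_Icc 0 1)
      (by have := continuous_sqProfile; fun_prop) ?_ ?_
    · rw [interior_Icc]
      intro y hy
      refine DifferentiableAt.differentiableWithinAt ?_
      refine DifferentiableAt.sub (DifferentiableAt.const_mul (DifferentiableAt.sqrt (by fun_prop) ?_) _)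
        (hasDerivAt_sqProfile hy.2).differentiableAt
      linarith [hy.2]
    · rw [interior_Icc]
      intro y hy
      have hw : 0 < √(1 - y) := Real.sqrt_pos.2 (by linarith [hy.2])
      have hd := ((((hasDerivAt_id y).const_sub 1).sqrt (by simp; linarith [hy.2])).const_mul 2).sub
        (hasDerivAt_sqProfile hy.2)
      simp only [id] at hd
      refine hd.deriv.le.trans ?_
      have hs : √y ≤ 1 := Real.sqrt_le_one.2 hy.2.le
      have : 2 * (-1 / (2 * √(1 - y))) - -√y / √(1 - y) = (√y - 1) / √(1 - y) := by
        field_simp; ring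
      rw [this]
      exact div_nonpos_of_nonpos_of_nonneg (by linarith) hw.le
  have := hanti ⟨hx, h⟩ ⟨zero_le_one, le_rfl⟩ h
  simp only [sub_self, Real.sqrt_zero, mul_zero, sqProfile_of_one_le le_rfl] at this
  linarith

lemma sqProfile_le_two {x : ℝ} (hx : 0 ≤ x) : sqProfile x ≤ 2 :=
  (sqProfile_le hx).trans (by
    have : √(1 - x) ≤ 1 := Real.sqrt_le_one.2 (by linarith)
    linarith)

/-- Follows from cos x ≥ 1 - x² / 2 at x = arccos (1 - ε). It supplies c² ≥ 2ε, the source of √ε in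
the second estimate. -/
lemma sqrt_le_profile {ε : ℝ} (h0 : 0 ≤ ε) (h1 : ε ≤ 1) : √(2 * ε) ≤ profile (1 - ε) := by
  have ha : √(2 * ε) ≤ Real.arccos (1 - ε) := by
    rw [Real.sqrt_le_left (Real.arccos_nonneg _)]
    have := Real.one_sub_sq_div_two_le_cos (x := Real.arccos (1 - ε))
    rw [Real.cos_arccos (by linarith) (by linarith)] at this
    linarith
  exact ha.trans (le_add_of_nonneg_right (mul_nonneg (by linarith) (Real.sqrt_nonneg _)))

/-! ### Pansu's set as a bounded open region -/

lemma mem_pansuSet_iff {p : Heisenberg n} :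
    p ∈ pansuSet n ↔ |p.2| < sqProfile (sqNorm p.1) := by
  have h1 : radius p < 1 ↔ sqNorm p.1 < 1 := by
    rw [radius_eq, Real.sqrt_lt' one_pos, one_pow]
  refine ⟨fun h => h.1, fun h => ⟨h, h1.2 (sqProfile_pos_iff.1 ((abs_nonneg _).trans_lt h))⟩⟩

lemma isOpen_pansuSet : IsOpen (pansuSet n) := by
  have : pansuSet n = {p : Heisenberg n | |p.2| < sqProfile (sqNorm p.1)} :=
    Set.ext fun _ => mem_pansuSet_iff
  rw [this]
  exact isOpen_lt (by fun_prop) (continuous_sqProfile.comp (continuous_sqNorm.comp continuous_fst))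

lemma norm_le_of_sqNorm_le {z : Fin n → ℂ} {r : ℝ} (hr : 0 ≤ r) (h : sqNorm z ≤ r ^ 2) :
    ‖z‖ ≤ r := by
  refine (pi_norm_le_iff_of_nonneg hr).2 fun j => ?_
  refine le_of_sq_le_sq (le_trans ?_ h) hr
  exact Finset.single_le_sum (f := fun j => ‖z j‖ ^ 2) (fun _ _ => by positivity)
    (Finset.mem_univ j)

lemma pansuSet_subset : pansuSet n ⊆ Metric.closedBall 0 2 := by
  intro p hp
  have h := mem_pansuSet_iff.1 hp
  have h1 := sqProfile_pos_iff.1 ((abs_nonneg _).trans_lt h)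
  rw [mem_closedBall_zero_iff, Prod.norm_def, max_le_iff]
  exact ⟨norm_le_of_sqNorm_le (by norm_num) (by linarith),
    h.le.trans (sqProfile_le_two (sqNorm_nonneg _))⟩

lemma volume_pansuSet_ne_top : volume (pansuSet n) ≠ ⊤ :=
  ((measure_mono pansuSet_subset).trans_lt measure_closedBall_lt_top).ne

/-! ### The Gauss–Green formula on hypographs -/

/-- The vertical shear `(z, s) ↦ (z, s + g z)`. -/
def shear {g : (Fin n → ℂ) → ℝ} (hg : Continuous g) : Heisenberg n ≃ₜ Heisenberg n where
  toFun p := (p.1, p.2 + g p.1)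
  invFun p := (p.1, p.2 - g p.1)
  left_inv p := by simp
  right_inv p := by simp
  continuous_toFun := by fun_prop
  continuous_invFun := by fun_prop

lemma measurePreserving_shear {g : (Fin n → ℂ) → ℝ} (hg : Continuous g) :
    MeasurePreserving (shear hg) volume volume := by
  refine MeasurePreserving.skew_product (μa := volume) (μb := volume) (μc := volume) (μd := volume)
    (MeasurePreserving.id _) (g := fun z s => s + g z) ?_ ?_
  · exact (by fun_prop : Continuous (Function.uncurry fun (z : Fin n → ℂ) (s : ℝ) => s + g z)).measurable
  · exact Filter.Eventually.of_forall fun z => (measurePreserving_add_right volume (g z)).map_eq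

lemma integral_fderiv_eq_zero {E : Type*} [NormedAddCommGroup E] [NormedSpace ℝ E]
    [MeasurableSpace E] [BorelSpace E] [FiniteDimensional ℝ E] (μ : Measure E) [μ.IsAddHaarMeasure]
    {u : E → ℝ} (hu : ContDiff ℝ 1 u) (hc : HasCompactSupport u) (v : E) :
    ∫ x, fderiv ℝ u x v ∂μ = 0 := by
  have h := integral_mul_fderiv_eq_neg_fderiv_mul_of_integrable (μ := μ) (f := fun _ : E => (1 : ℝ))
    (g := u) (v := v) (by simp)
    (by
      simp only [one_mul]
      exact ((hu.continuous_fderiv one_ne_zero).clm_apply continuous_const).integrable_of_hasCompactSupport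
        (hc.fderiv_apply (𝕜 := ℝ) v))
    (by simpa using hu.continuous.integrable_of_hasCompactSupport hc)
    (fun x _ => differentiableAt_const _) (fun x _ => hu.differentiable one_ne_zero x)
  simpa using h

lemma hasCompactSupport_mk_left {u : Heisenberg n → ℝ} (hc : HasCompactSupport u) (z : Fin n → ℂ) :
    HasCompactSupport fun s => u (z, s) :=
  hc.comp_isClosedEmbedding (Isometry.isClosedEmbedding (f := fun s : ℝ => (z, s))
    (Isometry.of_dist_eq fun a b => by simp [Prod.dist_eq]))

lemma hasCompactSupport_mk_right {u : Heisenberg n → ℝ} (hc : HasCompactSupport u) (s : ℝ) :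
    HasCompactSupport fun z => u (z, s) :=
  hc.comp_isClosedEmbedding (Isometry.isClosedEmbedding (f := fun z : Fin n → ℂ => (z, s))
    (Isometry.of_dist_eq fun a b => by simp [Prod.dist_eq]))

/-- Gauss–Green below the graph of `g` for a scalar function and a field `(e, k z)`. -/
lemma setIntegral_fderiv_hypograph {g : (Fin n → ℂ) → ℝ} (hg : ContDiff ℝ 1 g)
    {u : Heisenberg n → ℝ} (hu : ContDiff ℝ 1 u) (hc : HasCompactSupport u) (e : Fin n → ℂ)
    {k : (Fin n → ℂ) → ℝ} (hk : Continuous k) :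
    ∫ p in {p : Heisenberg n | p.2 < g p.1}, fderiv ℝ u p (e, k p.1) =
      ∫ z, (k z - fderiv ℝ g z e) * u (z, g z) := by
  set S := shear hg.continuous
  set U : Heisenberg n → ℝ := fun p => u (p.1, p.2 + g p.1)
  have hS : ContDiff ℝ 1 (fun p : Heisenberg n => (p.1, p.2 + g p.1)) :=
    contDiff_fst.prodMk (contDiff_snd.add (hg.comp contDiff_fst))
  have hU : ContDiff ℝ 1 U := hu.comp hS
  have hUc : HasCompactSupport U := hc.comp_homeomorph S
  set d : (Fin n → ℂ) → ℝ := fun z => k z - fderiv ℝ g z e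
  have hd : Continuous d := hk.sub ((hg.continuous_fderiv one_ne_zero).clm_apply continuous_const)
  -- The shear flattens the graph. The field becomes e, whose derivative integrates to zero over
  -- every horizontal slice, plus (k - ∂ₑg) ∂ₜ, which the fundamental theorem of calculus evaluates
  -- at height 0.
  have key : ∀ p : Heisenberg n, fderiv ℝ u (S p) (e, k p.1) =
      fderiv ℝ U p (e, 0) + d p.1 * fderiv ℝ U p (0, 1) := by
    intro p
    have hSd : HasFDerivAt (fun p : Heisenberg n => (p.1, p.2 + g p.1))
        ((ContinuousLinearMap.fst ℝ _ _).prod (ContinuousLinearMap.snd ℝ _ _ +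
          (fderiv ℝ g p.1).comp (ContinuousLinearMap.fst ℝ _ _))) p :=
      hasFDerivAt_fst.prodMk (hasFDerivAt_snd.add
        ((hg.differentiable one_ne_zero p.1).hasFDerivAt.comp p hasFDerivAt_fst))
    have hUd := ((hu.differentiable one_ne_zero (S p)).hasFDerivAt.comp p hSd).fderiv
    change fderiv ℝ U p = _ at hUd
    have h2 : fderiv ℝ U p (e, 0) + d p.1 * fderiv ℝ U p (0, 1) = fderiv ℝ U p (e, d p.1) := by
      rw [← smul_eq_mul, ← map_smul, ← map_add]; simp
    rw [h2, hUd]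
    simp [d]
  have hcont : Continuous (fderiv ℝ U) := hU.continuous_fderiv one_ne_zero
  have hi1 : Integrable (fun p => fderiv ℝ U p (e, 0)) :=
    (hcont.clm_apply continuous_const).integrable_of_hasCompactSupport
      (hUc.fderiv_apply (𝕜 := ℝ) (e, 0))
  have hi2 : Integrable (fun p : Heisenberg n => d p.1 * fderiv ℝ U p (0, 1)) := by
    refine Continuous.integrable_of_hasCompactSupport (by fun_prop) ?_
    exact (hUc.fderiv_apply (𝕜 := ℝ) (0, 1)).mul_left
  have hset : S ⁻¹' {p : Heisenberg n | p.2 < g p.1} = Set.univ ×ˢ Set.Iio 0 := by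
    ext p; simp [S, shear]
  rw [← (measurePreserving_shear hg.continuous).setIntegral_preimage_emb
    S.measurableEmbedding, hset]
  change ∫ p in _, fderiv ℝ u (S p) (e, k p.1) = _
  simp only [key]
  rw [integral_add hi1.integrableOn hi2.integrableOn]
  have hv : (volume : Measure (Heisenberg n)).restrict (Set.univ ×ˢ Set.Iio 0) =
      (volume : Measure (Fin n → ℂ)).prod (volume.restrict (Set.Iio (0 : ℝ))) := by
    rw [Measure.volume_eq_prod, ← Measure.prod_restrict, Measure.restrict_univ]
  have e1 : ∫ p in Set.univ ×ˢ Set.Iio 0, fderiv ℝ U p (e, 0) = 0 := by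
    rw [hv, integral_prod_symm _ (by rw [← hv]; exact hi1.integrableOn)]
    refine integral_eq_zero_of_ae (Filter.Eventually.of_forall fun s => ?_)
    have hs : ContDiff ℝ 1 (fun z => U (z, s)) := hU.comp (contDiff_id.prodMk contDiff_const)
    have := integral_fderiv_eq_zero volume hs (hasCompactSupport_mk_right hUc s) e
    refine Eq.trans (integral_congr_ae (Filter.Eventually.of_forall fun z => ?_)) this
    have hι : HasFDerivAt (fun z : Fin n → ℂ => (z, s))
        ((ContinuousLinearMap.id ℝ (Fin n → ℂ)).prod 0) z :=
      (hasFDerivAt_id z).prodMk (hasFDerivAt_const s z)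
    have h := (HasFDerivAt.comp z (hU.differentiable one_ne_zero (z, s)).hasFDerivAt hι).fderiv
    change fderiv ℝ (fun z => U (z, s)) z = _ at h
    simp only [h]
    simp
  have e2 : ∫ p in Set.univ ×ˢ Set.Iio 0, d p.1 * fderiv ℝ U p (0, 1) = ∫ z, d z * u (z, g z) := by
    rw [hv, integral_prod _ (by rw [← hv]; exact hi2.integrableOn)]
    refine integral_congr_ae (Filter.Eventually.of_forall fun z => ?_)
    have hs : ContDiff ℝ 1 (fun s => U (z, s)) := hU.comp (contDiff_const.prodMk contDiff_id)
    have hI := HasCompactSupport.integral_Iic_deriv_eq hs (hasCompactSupport_mk_left hUc z) 0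
    have hder : ∀ s, deriv (fun s => U (z, s)) s = fderiv ℝ U (z, s) (0, 1) := by
      intro s
      have h := ((hU.differentiable one_ne_zero (z, s)).hasFDerivAt.comp_hasDerivAt s
        ((hasDerivAt_const s z).prodMk (hasDerivAt_id s))).deriv
      exact h
    simp only [hder] at hI
    change ∫ s in Set.Iio 0, d z * fderiv ℝ U (z, s) (0, 1) = d z * u (z, g z)
    rw [integral_const_mul, ← integral_Iic_eq_integral_Iio, hI]
    simp [U]
  rw [e1, e2, zero_add]

/-! ### Horizontal divergence and flux through a graph -/

lemma continuous_fieldX (j : Fin n) : Continuous (fieldX j : Heisenberg n → Heisenberg n) := by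
  unfold fieldX; fun_prop

lemma continuous_fieldY (j : Fin n) : Continuous (fieldY j : Heisenberg n → Heisenberg n) := by
  unfold fieldY; fun_prop

lemma contDiff_coord {V : Heisenberg n → EuclideanSpace ℝ (Fin n ⊕ Fin n)} (hV : ContDiff ℝ 1 V)
    (i : Fin n ⊕ Fin n) : ContDiff ℝ 1 fun p => V p i :=
  contDiff_euclidean.1 hV i

lemma hasCompactSupport_coord {V : Heisenberg n → EuclideanSpace ℝ (Fin n ⊕ Fin n)}
    (hc : HasCompactSupport V) (i : Fin n ⊕ Fin n) : HasCompactSupport fun p => V p i :=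
  hc.comp_left (g := fun v : EuclideanSpace ℝ (Fin n ⊕ Fin n) => v i) rfl

lemma hasCompactSupport_fderiv_field {u : Heisenberg n → ℝ} (hc : HasCompactSupport u)
    (X : Heisenberg n → Heisenberg n) : HasCompactSupport fun p => fderiv ℝ u p (X p) :=
  (hc.fderiv (𝕜 := ℝ)).mono fun p hp h => hp (by simp [h])

lemma integrable_divH {V : Heisenberg n → EuclideanSpace ℝ (Fin n ⊕ Fin n)} (hV : ContDiff ℝ 1 V)
    (hc : HasCompactSupport V) : Integrable (divH V) := by
  refine integrable_finsetSum _ fun j _ => Integrable.add ?_ ?_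
  · exact (((contDiff_coord hV _).continuous_fderiv one_ne_zero).clm_apply
      (continuous_fieldX j)).integrable_of_hasCompactSupport (μ := volume)
        (hasCompactSupport_fderiv_field (hasCompactSupport_coord hc _) _)
  · exact (((contDiff_coord hV _).continuous_fderiv one_ne_zero).clm_apply
      (continuous_fieldY j)).integrable_of_hasCompactSupport (μ := volume)
        (hasCompactSupport_fderiv_field (hasCompactSupport_coord hc _) _)

/-- The flux density of `V` through the graph of `g`: the pairing of `V` with `∇_H (t - g)`. -/
def graphFlux (g : (Fin n → ℂ) → ℝ) (V : Heisenberg n → EuclideanSpace ℝ (Fin n ⊕ Fin n))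
    (z : Fin n → ℂ) : ℝ :=
  ∑ j, ((2 * (z j).im - fderiv ℝ g z (Pi.single j 1)) * V (z, g z) (Sum.inl j) +
    (-2 * (z j).re - fderiv ℝ g z (Pi.single j Complex.I)) * V (z, g z) (Sum.inr j))

lemma integrable_graph_term {g : (Fin n → ℂ) → ℝ} (hg : ContDiff ℝ 1 g)
    {u : Heisenberg n → ℝ} (hu : ContDiff ℝ 1 u) (hc : HasCompactSupport u) (e : Fin n → ℂ)
    {k : (Fin n → ℂ) → ℝ} (hk : Continuous k) :
    Integrable fun z => (k z - fderiv ℝ g z e) * u (z, g z) := by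
  have hd : Continuous fun z => fderiv ℝ g z e :=
    (hg.continuous_fderiv one_ne_zero).clm_apply continuous_const
  have hgc := hg.continuous
  have huc := hu.continuous
  refine Continuous.integrable_of_hasCompactSupport (by fun_prop) ?_
  have hU := hc.comp_homeomorph (shear hgc)
  exact (hasCompactSupport_mk_right hU 0).mono fun z hz h => hz (by
    simp [shear] at h; simp [h])

lemma integrable_graphFlux {g : (Fin n → ℂ) → ℝ} (hg : ContDiff ℝ 1 g)
    {V : Heisenberg n → EuclideanSpace ℝ (Fin n ⊕ Fin n)} (hV : ContDiff ℝ 1 V)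
    (hc : HasCompactSupport V) : Integrable (graphFlux g V) :=
  integrable_finsetSum _ fun j _ => Integrable.add
    (integrable_graph_term hg (contDiff_coord hV _) (hasCompactSupport_coord hc _) _ (by fun_prop))
    (integrable_graph_term hg (contDiff_coord hV _) (hasCompactSupport_coord hc _) _ (by fun_prop))

/-- The Gauss–Green formula below a `C¹` graph. -/
lemma setIntegral_divH_hypograph {g : (Fin n → ℂ) → ℝ} (hg : ContDiff ℝ 1 g)
    {V : Heisenberg n → EuclideanSpace ℝ (Fin n ⊕ Fin n)} (hV : ContDiff ℝ 1 V)
    (hc : HasCompactSupport V) :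
    ∫ p in {p : Heisenberg n | p.2 < g p.1}, divH V p = ∫ z, graphFlux g V z := by
  have hX := fun j : Fin n => (((contDiff_coord hV (Sum.inl j)).continuous_fderiv one_ne_zero).clm_apply
      (continuous_fieldX j)).integrable_of_hasCompactSupport (μ := volume)
        (hasCompactSupport_fderiv_field (hasCompactSupport_coord hc _) _)
  have hY := fun j : Fin n => (((contDiff_coord hV (Sum.inr j)).continuous_fderiv one_ne_zero).clm_apply
      (continuous_fieldY j)).integrable_of_hasCompactSupport (μ := volume)
        (hasCompactSupport_fderiv_field (hasCompactSupport_coord hc _) _)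
  have hGX := fun j : Fin n => integrable_graph_term hg (contDiff_coord hV (Sum.inl j))
    (hasCompactSupport_coord hc _) (Pi.single j 1) (k := fun z => 2 * (z j).im) (by fun_prop)
  have hGY := fun j : Fin n => integrable_graph_term hg (contDiff_coord hV (Sum.inr j))
    (hasCompactSupport_coord hc _) (Pi.single j Complex.I) (k := fun z => -2 * (z j).re)
    (by fun_prop)
  have e1 : ∫ p in {p : Heisenberg n | p.2 < g p.1}, divH V p = _ :=
    integral_finsetSum _ fun j _ => ((hX j).add (hY j)).integrableOn
  have e2 : ∫ z, graphFlux g V z = _ := integral_finsetSum _ fun j _ => (hGX j).add (hGY j)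
  rw [e1, e2]
  refine Finset.sum_congr rfl fun j _ => ?_
  refine (integral_add (hX j).integrableOn (hY j).integrableOn).trans
    (Eq.trans ?_ (integral_add (hGX j) (hGY j)).symm)
  congr 1
  · exact setIntegral_fderiv_hypograph hg (contDiff_coord hV _) (hasCompactSupport_coord hc _)
      (Pi.single j 1) (k := fun z => 2 * (z j).im) (by fun_prop)
  · exact setIntegral_fderiv_hypograph hg (contDiff_coord hV _) (hasCompactSupport_coord hc _)
      (Pi.single j Complex.I) (k := fun z => -2 * (z j).re) (by fun_prop)

/-- The Gauss–Green formula between the graphs of `-g` and `g`. -/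
lemma setIntegral_divH_between {g : (Fin n → ℂ) → ℝ} (hg : ContDiff ℝ 1 g) (h0 : ∀ z, 0 ≤ g z)
    {V : Heisenberg n → EuclideanSpace ℝ (Fin n ⊕ Fin n)} (hV : ContDiff ℝ 1 V)
    (hc : HasCompactSupport V) :
    ∫ p in {p : Heisenberg n | -g p.1 ≤ p.2 ∧ p.2 < g p.1}, divH V p =
      ∫ z, (graphFlux g V z - graphFlux (fun z => -g z) V z) := by
  have hgc := hg.continuous
  rw [integral_sub (integrable_graphFlux hg hV hc) (integrable_graphFlux hg.neg hV hc),
    ← setIntegral_divH_hypograph hg hV hc, ← setIntegral_divH_hypograph hg.neg hV hc,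
    eq_sub_iff_add_eq, ← setIntegral_union ?_ ?_ (integrable_divH hV hc).integrableOn
      (integrable_divH hV hc).integrableOn]
  · congr 2
    ext p
    have := h0 p.1
    simp only [Set.mem_union, Set.mem_ofPred_eq]
    constructor
    · rintro (h | h) <;> linarith
    · intro h
      rcases lt_or_ge p.2 (-g p.1) with h' | h'
      · exact Or.inr h'
      · exact Or.inl ⟨h', h⟩
  · rw [Set.disjoint_left]
    rintro p ⟨h, _⟩ h'
    exact absurd h' (not_lt.2 h)
  · exact measurableSet_lt (by fun_prop) (by fun_prop)

/-! ### A `C¹` soft threshold -/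

lemma hasDerivAt_max_zero_sq (x : ℝ) : HasDerivAt (fun x : ℝ => max x 0 ^ 2) (2 * max x 0) x := by
  have hne : ∀ y : ℝ, y ≠ 0 → HasDerivAt (fun x : ℝ => max x 0 ^ 2) (2 * max y 0) y := by
    intro y hy
    rcases lt_or_gt_of_ne hy with h | h
    · have he : (fun x : ℝ => max x 0 ^ 2) =ᶠ[nhds y] fun _ => 0 := by
        filter_upwards [gt_mem_nhds h] with u hu
        simp [max_eq_right hu.le]
      rw [max_eq_right h.le, mul_zero]
      exact (hasDerivAt_const y (0 : ℝ)).congr_of_eventuallyEq he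
    · have he : (fun x : ℝ => max x 0 ^ 2) =ᶠ[nhds y] fun x => x ^ 2 := by
        filter_upwards [lt_mem_nhds h] with u hu
        simp [max_eq_left hu.le]
      rw [max_eq_left h.le]
      refine ((hasDerivAt_pow 2 y).congr_of_eventuallyEq he).congr_deriv ?_
      simp
  exact hasDerivAt_of_hasDerivAt_of_ne' hne (by fun_prop) (by fun_prop) x

/-- A `C¹` approximation of `x ↦ max x 0` that vanishes for `x ≤ δ`. -/
def softThreshold (δ x : ℝ) : ℝ := √(max (x - δ) 0 ^ 2 + δ ^ 2) - δ

/-- The derivative of `softThreshold δ`. -/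
def softThresholdDeriv (δ x : ℝ) : ℝ := max (x - δ) 0 / √(max (x - δ) 0 ^ 2 + δ ^ 2)

lemma hasDerivAt_softThreshold {δ : ℝ} (hδ : 0 < δ) (x : ℝ) :
    HasDerivAt (softThreshold δ) (softThresholdDeriv δ x) x := by
  have h1 : HasDerivAt (fun x : ℝ => max (x - δ) 0 ^ 2) (2 * max (x - δ) 0) x := by
    have := (hasDerivAt_max_zero_sq (x - δ)).comp x ((hasDerivAt_id x).sub_const δ)
    rw [mul_one] at this
    exact this
  have hpos : 0 < max (x - δ) 0 ^ 2 + δ ^ 2 := by positivity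
  refine (((h1.add_const (δ ^ 2)).sqrt hpos.ne').sub_const δ).congr_deriv ?_
  rw [softThresholdDeriv, mul_div_mul_left _ _ two_ne_zero]

lemma contDiff_softThreshold {δ : ℝ} (hδ : 0 < δ) : ContDiff ℝ 1 (softThreshold δ) := by
  refine contDiff_one_iff_deriv.2
    ⟨fun x => (hasDerivAt_softThreshold hδ x).differentiableAt, ?_⟩
  have : deriv (softThreshold δ) = softThresholdDeriv δ :=
    funext fun x => (hasDerivAt_softThreshold hδ x).deriv
  rw [this]
  unfold softThresholdDeriv
  refine Continuous.div (by fun_prop) (by fun_prop) fun x => ?_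
  have hpos : 0 < max (x - δ) 0 ^ 2 + δ ^ 2 := by positivity
  exact (Real.sqrt_pos.2 hpos).ne'

lemma softThresholdDeriv_nonneg (δ x : ℝ) : 0 ≤ softThresholdDeriv δ x :=
  div_nonneg (le_max_right _ _) (Real.sqrt_nonneg _)

lemma softThresholdDeriv_le_one (δ x : ℝ) : softThresholdDeriv δ x ≤ 1 := by
  refine div_le_one_of_le₀ (Real.le_sqrt_of_sq_le ?_) (Real.sqrt_nonneg _)
  have := sq_nonneg δ
  linarith

lemma softThreshold_of_le {δ x : ℝ} (hδ : 0 ≤ δ) (h : x ≤ δ) : softThreshold δ x = 0 := by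
  rw [softThreshold, max_eq_right (by linarith)]
  simp [Real.sqrt_sq hδ]

lemma softThreshold_nonneg (δ x : ℝ) : 0 ≤ softThreshold δ x := by
  rw [softThreshold, sub_nonneg]
  refine Real.le_sqrt_of_sq_le ?_
  have := sq_nonneg (max (x - δ) 0)
  linarith

/-- The smoothing is from below: regions between smoothed hemispheres stay inside Pansu's set, and
the smoothed leaf parameter stays admissible in `slope_comparison`. -/
lemma softThreshold_le {δ : ℝ} (hδ : 0 ≤ δ) (x : ℝ) : softThreshold δ x ≤ max (x - δ) 0 := by
  rw [softThreshold, sub_le_iff_le_add, Real.sqrt_le_left (by positivity)]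
  have : 0 ≤ max (x - δ) 0 := le_max_right _ _
  nlinarith

lemma le_softThreshold {δ : ℝ} (x : ℝ) : x - 2 * δ ≤ softThreshold δ x := by
  have h1 : max (x - δ) 0 ≤ √(max (x - δ) 0 ^ 2 + δ ^ 2) :=
    Real.le_sqrt_of_sq_le (by have := sq_nonneg δ; linarith)
  have h2 : x - δ ≤ max (x - δ) 0 := le_max_left _ _
  rw [softThreshold]
  linarith

/-! ### Radial graphs and their horizontal area -/

/-- The density `2 r / √(1 - r²)` of the `H`-perimeter of one hemisphere of Pansu's set over the
horizontal plane; it vanishes outside the unit ball. -/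
def areaDensity (z : Fin n → ℂ) : ℝ := 2 * √(sqNorm z) / √(1 - sqNorm z)

lemma areaDensity_nonneg (z : Fin n → ℂ) : 0 ≤ areaDensity z := by
  unfold areaDensity; positivity

lemma areaDensity_of_one_le {z : Fin n → ℂ} (h : 1 ≤ sqNorm z) : areaDensity z = 0 := by
  rw [areaDensity, Real.sqrt_eq_zero_of_nonpos (by linarith : 1 - sqNorm z ≤ 0), div_zero]

/-- The profile has a vertical tangent at the rim |z| = 1; composing with a function that vanishes
for small heights removes it. -/
lemma contDiff_radial {h : ℝ → ℝ} (hh : ContDiff ℝ 1 h) {δ : ℝ} (hδ : 0 < δ)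
    (h0 : ∀ x ≤ δ, h x = 0) : ContDiff ℝ 1 fun z : Fin n → ℂ => h (sqProfile (sqNorm z)) := by
  rw [contDiff_iff_contDiffAt]
  intro z
  rcases lt_or_ge (sqNorm z) 1 with hz | hz
  · exact hh.contDiffAt.comp z ((contDiffAt_sqProfile hz).comp z contDiff_sqNorm.contDiffAt)
  · refine (contDiffAt_const (c := (0 : ℝ))).congr_of_eventuallyEq ?_
    have : ∀ᶠ y in nhds z, sqProfile (sqNorm y) < δ :=
      (continuous_sqProfile.comp continuous_sqNorm).continuousAt.eventually_lt_const
        (by simpa [sqProfile_of_one_le hz] using hδ)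
    filter_upwards [this] with y hy using h0 _ hy.le

lemma hasFDerivAt_radial {h : ℝ → ℝ} {h' : ℝ} {z : Fin n → ℂ} (hz : sqNorm z < 1)
    (hh : HasDerivAt h h' (sqProfile (sqNorm z))) :
    HasFDerivAt (fun z : Fin n → ℂ => h (sqProfile (sqNorm z)))
      ((h' * (-√(sqNorm z) / √(1 - sqNorm z))) • sqNormDeriv z) z :=
  (hh.comp _ (hasDerivAt_sqProfile hz)).comp_hasFDerivAt z (hasFDerivAt_sqNorm z)

lemma graphFlux_congr {g g' : (Fin n → ℂ) → ℝ} {z : Fin n → ℂ} (h : g =ᶠ[nhds z] g')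
    (V : Heisenberg n → EuclideanSpace ℝ (Fin n ⊕ Fin n)) :
    graphFlux g V z = graphFlux g' V z := by
  simp only [graphFlux, h.fderiv_eq, h.eq_of_nhds]

lemma graphFlux_of_fderiv {g : (Fin n → ℂ) → ℝ} {z : Fin n → ℂ} {G : ℝ}
    (hG : fderiv ℝ g z = G • sqNormDeriv z)
    (V : Heisenberg n → EuclideanSpace ℝ (Fin n ⊕ Fin n)) :
    graphFlux g V z = ∑ j, ((2 * (z j).im - G * (2 * (z j).re)) * V (z, g z) (Sum.inl j) +
      (-2 * (z j).re - G * (2 * (z j).im)) * V (z, g z) (Sum.inr j)) := by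
  simp only [graphFlux, hG, _root_.smul_apply, sqNormDeriv_single_one,
    sqNormDeriv_single_I, smul_eq_mul]

lemma graphFlux_radialField {g : (Fin n → ℂ) → ℝ} {z : Fin n → ℂ} {G : ℝ}
    (hG : fderiv ℝ g z = G • sqNormDeriv z) (A B : Heisenberg n → ℝ) :
    graphFlux g (radialField A B) z = 2 * sqNorm z * (B (z, g z) - G * A (z, g z)) := by
  rw [graphFlux_of_fderiv hG, sqNorm_eq, Finset.mul_sum, Finset.sum_mul]
  refine Finset.sum_congr rfl fun j _ => ?_
  simp only [radialField, Sum.elim_inl, Sum.elim_inr]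
  ring

/-- Cauchy–Schwarz against the horizontal gradient ν of t - g. The twist of the frame and the slope
of g contribute orthogonal parts to ν, so |ν|² = 4|z|² (1 + G²). -/
lemma abs_graphFlux_le {g : (Fin n → ℂ) → ℝ} {z : Fin n → ℂ} {G : ℝ}
    (hG : fderiv ℝ g z = G • sqNormDeriv z)
    {V : Heisenberg n → EuclideanSpace ℝ (Fin n ⊕ Fin n)} (hV : ∀ p, ‖V p‖ ≤ 1) :
    |graphFlux g V z| ≤ 2 * √(sqNorm z * (1 + G ^ 2)) := by
  set ν : EuclideanSpace ℝ (Fin n ⊕ Fin n) :=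
    WithLp.toLp 2 (Sum.elim (fun j => 2 * (z j).im - G * (2 * (z j).re))
      (fun j => -2 * (z j).re - G * (2 * (z j).im)))
  have hν : ‖ν‖ ^ 2 = 4 * (sqNorm z * (1 + G ^ 2)) := by
    rw [norm_sq_horizontal, sqNorm_eq, Finset.sum_mul, Finset.mul_sum]
    refine Finset.sum_congr rfl fun j _ => ?_
    simp only [ν, Sum.elim_inl, Sum.elim_inr]
    ring
  have hnorm : ‖ν‖ = 2 * √(sqNorm z * (1 + G ^ 2)) := by
    rw [← Real.sqrt_sq (norm_nonneg ν), hν, Real.sqrt_mul (by norm_num)]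
    congr 1
    rw [show (4 : ℝ) = 2 ^ 2 by norm_num, Real.sqrt_sq (by norm_num)]
  have hin : graphFlux g V z = inner ℝ ν (V (z, g z)) := by
    rw [graphFlux_of_fderiv hG, PiLp.inner_apply, Fintype.sum_sum_type, Finset.sum_add_distrib]
    simp [ν, mul_comm]
  rw [hin, ← hnorm]
  refine (abs_real_inner_le_norm _ _).trans ?_
  exact mul_le_of_le_one_right (norm_nonneg _) (hV _)

/-- For |h'| = 1 this is the identity N (1 + N / (1 - N)) = N / (1 - N); flattening the profile
cannot increase the area density. -/
lemma sqrt_slope_le {z : Fin n → ℂ} (hz : sqNorm z < 1) {h' : ℝ} (h0 : |h'| ≤ 1) :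
    2 * √(sqNorm z * (1 + (h' * (-√(sqNorm z) / √(1 - sqNorm z))) ^ 2)) ≤ areaDensity z := by
  have hN := sqNorm_nonneg z
  have h1 : 0 < 1 - sqNorm z := by linarith
  rw [areaDensity, mul_div_assoc, ← Real.sqrt_div hN]
  refine mul_le_mul_of_nonneg_left (Real.sqrt_le_sqrt ?_) (by norm_num)
  rw [mul_pow, div_pow, neg_sq, Real.sq_sqrt hN, Real.sq_sqrt h1.le]
  have : h' ^ 2 ≤ 1 := (sq_le_one_iff_abs_le_one h').2 h0
  have hq : 0 ≤ sqNorm z / (1 - sqNorm z) := div_nonneg hN h1.le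
  have e : sqNorm z / (1 - sqNorm z) = sqNorm z * (1 + 1 * (sqNorm z / (1 - sqNorm z))) := by
    field_simp; ring
  refine le_of_le_of_eq (mul_le_mul_of_nonneg_left ?_ hN) e.symm
  gcongr

/-- The flux of a test field through a pair of smoothed hemispheres. -/
lemma graphFlux_sub_le {δ : ℝ} (hδ : 0 < δ)
    {V : Heisenberg n → EuclideanSpace ℝ (Fin n ⊕ Fin n)} (hV : ∀ p, ‖V p‖ ≤ 1) (z : Fin n → ℂ) :
    graphFlux (fun z => softThreshold δ (sqProfile (sqNorm z))) V z -
      graphFlux (fun z => -softThreshold δ (sqProfile (sqNorm z))) V z ≤ 2 * areaDensity z := by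
  rcases lt_or_ge (sqNorm z) 1 with hz | hz
  · have hd := hasFDerivAt_radial hz (hasDerivAt_softThreshold hδ (sqProfile (sqNorm z)))
    have h1 : |softThresholdDeriv δ (sqProfile (sqNorm z))| ≤ 1 := by
      rw [abs_of_nonneg (softThresholdDeriv_nonneg _ _)]
      exact softThresholdDeriv_le_one _ _
    have hn : HasFDerivAt (fun z : Fin n → ℂ => -softThreshold δ (sqProfile (sqNorm z)))
        ((-softThresholdDeriv δ (sqProfile (sqNorm z)) * (-√(sqNorm z) / √(1 - sqNorm z))) •
          sqNormDeriv z) z := by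
      refine hd.neg.congr_fderiv ?_
      ext v
      simp
    have b1 := (abs_graphFlux_le hd.fderiv hV).trans (sqrt_slope_le hz h1)
    have b2 := (abs_graphFlux_le hn.fderiv hV).trans (sqrt_slope_le hz (by rwa [abs_neg]))
    have c1 := (abs_le.1 b1).2
    have c2 := (abs_le.1 b2).1
    linarith
  · have hev : ∀ᶠ y in nhds z, sqProfile (sqNorm y) < δ :=
      (continuous_sqProfile.comp continuous_sqNorm).continuousAt.eventually_lt_const
        (by simpa [sqProfile_of_one_le hz] using hδ)
    have e1 : (fun z : Fin n → ℂ => softThreshold δ (sqProfile (sqNorm z))) =ᶠ[nhds z]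
        fun z => -softThreshold δ (sqProfile (sqNorm z)) := by
      filter_upwards [hev] with y hy
      rw [softThreshold_of_le hδ.le hy.le, neg_zero]
    rw [graphFlux_congr e1, sub_self]
    exact mul_nonneg two_pos.le (areaDensity_nonneg z)

/-- In polar coordinates the only singularity is at r = 1, where 2r / √(1 - r²) is the derivative of
the continuous function -2√(1 - r²); the power of r in the Jacobian is at most 1 there. -/
lemma integrable_areaDensity (hn : 1 ≤ n) : Integrable (areaDensity : (Fin n → ℂ) → ℝ) := by
  set L : (Fin n → ℂ) ≃L[ℝ] EuclideanSpace ℂ (Fin n) :=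
    (PiLp.continuousLinearEquiv 2 ℝ fun _ : Fin n => ℂ).symm
  have : Nonempty (Fin n) := ⟨⟨0, hn⟩⟩
  let _ : MeasurableSpace (EuclideanSpace ℂ (Fin n)) := borel _
  have : BorelSpace (EuclideanSpace ℂ (Fin n)) := ⟨rfl⟩
  have hμ := ContinuousLinearEquiv.isAddHaarMeasure_map L (volume : Measure (Fin n → ℂ))
  have hfun : (areaDensity : (Fin n → ℂ) → ℝ) =
      (fun x => (fun y => 2 * y / √(1 - y ^ 2)) ‖x‖) ∘ L := by
    ext z
    have : ‖L z‖ = √(sqNorm z) := by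
      rw [EuclideanSpace.norm_eq]; rfl
    simp only [Function.comp, this, areaDensity, Real.sq_sqrt (sqNorm_nonneg z)]
  rw [hfun]
  refine (integrable_map_equiv (L.toHomeomorph.toMeasurableEquiv) _).1 ?_
  refine (integrable_fun_norm_addHaar (f := fun y : ℝ => 2 * y / √(1 - y ^ 2))
    (Measure.map L volume)).2 ?_
  have hbase : IntegrableOn (fun y : ℝ => 2 * y / √(1 - y ^ 2)) (Set.Ioc 0 1) := by
    refine intervalIntegral.integrableOn_deriv_of_nonneg (g := fun y => -(2 * √(1 - y ^ 2)))
      (by fun_prop) (fun y hy => ?_) (fun y hy => ?_)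
    · have hy' : (1 : ℝ) - y ^ 2 ≠ 0 := by nlinarith [hy.1, hy.2]
      have h1 : HasDerivAt (fun y : ℝ => 1 - y ^ 2) (-(2 * y)) y := by
        simpa using (hasDerivAt_pow 2 y).const_sub 1
      refine ((h1.sqrt hy').const_mul 2).neg.congr_deriv ?_
      have : √(1 - y ^ 2) ≠ 0 := (Real.sqrt_pos.2 (by nlinarith [hy.1, hy.2])).ne'
      field_simp
    · exact div_nonneg (by linarith [hy.1]) (Real.sqrt_nonneg _)
  have hsplit : Set.Ioi (0 : ℝ) = Set.Ioc 0 1 ∪ Set.Ioi 1 :=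
    (Set.Ioc_union_Ioi_eq_Ioi zero_le_one).symm
  rw [hsplit]
  refine IntegrableOn.union ?_ ?_
  · refine Integrable.mono' hbase ?_ ?_
    · exact (by fun_prop : Measurable fun y : ℝ =>
        y ^ (Module.finrank ℝ (EuclideanSpace ℂ (Fin n)) - 1) • (2 * y / √(1 - y ^ 2))).aestronglyMeasurable
    · refine (ae_restrict_iff' measurableSet_Ioc).2 (Filter.Eventually.of_forall fun y hy => ?_)
      have h0 : 0 ≤ 2 * y / √(1 - y ^ 2) := div_nonneg (by linarith [hy.1]) (Real.sqrt_nonneg _)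
      rw [norm_smul, Real.norm_of_nonneg h0, norm_pow, Real.norm_of_nonneg hy.1.le]
      exact mul_le_of_le_one_left h0 (pow_le_one₀ hy.1.le hy.2)
  · refine integrableOn_zero.congr_fun (fun y hy => ?_) measurableSet_Ioi
    have : (1 : ℝ) - y ^ 2 ≤ 0 := by nlinarith [Set.mem_Ioi.1 hy]
    simp [Real.sqrt_eq_zero_of_nonpos this]

/-- The `H`-perimeter of Pansu's set is at most the horizontal area of its two hemispheres. -/
lemma perimeter_pansuSet_le (hn : 1 ≤ n) :
    perimeter (pansuSet n) ≤ ENNReal.ofReal (2 * ∫ z : Fin n → ℂ, areaDensity z) := by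
  refine iSup₂_le fun V hV => ENNReal.ofReal_le_ofReal ?_
  obtain ⟨hV1, hVc, -, hVn⟩ := hV
  set δ : ℕ → ℝ := fun k => 1 / (k + 1 : ℝ)
  have hδ : ∀ k, 0 < δ k := fun k => by positivity
  have hδ0 : Filter.Tendsto δ Filter.atTop (nhds 0) := tendsto_one_div_add_atTop_nhds_zero_nat
  set g : ℕ → (Fin n → ℂ) → ℝ := fun k z => softThreshold (δ k) (sqProfile (sqNorm z))
  have hg : ∀ k, ContDiff ℝ 1 (g k) := fun k =>
    contDiff_radial (contDiff_softThreshold (hδ k)) (hδ k) fun x hx =>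
      softThreshold_of_le (hδ k).le hx
  set S : ℕ → Set (Heisenberg n) := fun k => {p | -g k p.1 ≤ p.2 ∧ p.2 < g k p.1}
  have hS : ∀ k, MeasurableSet (S k) := fun k => by
    have hm : Measurable fun p : Heisenberg n => g k p.1 :=
      (hg k).continuous.measurable.comp measurable_fst
    exact (measurableSet_le hm.neg measurable_snd).inter (measurableSet_lt measurable_snd hm)
  have hbound : ∀ k, ∫ p in S k, divH V p ≤ 2 * ∫ z : Fin n → ℂ, areaDensity z := by
    intro k
    rw [setIntegral_divH_between (hg k) (fun z => softThreshold_nonneg _ _) hV1 hVc,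
      ← integral_const_mul]
    exact integral_mono ((integrable_graphFlux (hg k) hV1 hVc).sub
      (integrable_graphFlux (hg k).neg hV1 hVc)) ((integrable_areaDensity hn).const_mul 2)
      (fun z => graphFlux_sub_le (hδ k) hVn z)
  have hint := integrable_divH hV1 hVc
  -- Every S k lies in Pansu's set, and a point of Pansu's set lies in S k as soon as 2 δ k is less
  -- than its vertical distance to the boundary.
  have hlim : Filter.Tendsto (fun k => ∫ p in S k, divH V p) Filter.atTop
      (nhds (∫ p in pansuSet n, divH V p)) := by
    simp only [← integral_indicator (hS _)]
    rw [← integral_indicator isOpen_pansuSet.measurableSet]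
    refine tendsto_integral_of_dominated_convergence (fun p => ‖divH V p‖)
      (fun k => (hint.indicator (hS k)).aestronglyMeasurable) hint.norm
      (fun k => Filter.Eventually.of_forall fun p => norm_indicator_le_norm_self _ _)
      (Filter.Eventually.of_forall fun p => ?_)
    refine tendsto_const_nhds.congr' ?_
    by_cases hp : p ∈ pansuSet n
    · rw [Set.indicator_of_mem hp]
      have hlt := mem_pansuSet_iff.1 hp
      have : ∀ᶠ k in Filter.atTop, δ k < (sqProfile (sqNorm p.1) - |p.2|) / 2 :=
        hδ0.eventually_lt_const (by linarith)
      filter_upwards [this] with k hk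
      have h2 : |p.2| < g k p.1 := by
        have := le_softThreshold (δ := δ k) (sqProfile (sqNorm p.1))
        change |p.2| < softThreshold (δ k) (sqProfile (sqNorm p.1))
        linarith
      rw [Set.indicator_of_mem]
      exact ⟨(abs_lt.1 h2).1.le, (abs_lt.1 h2).2⟩
    · rw [Set.indicator_of_notMem hp]
      refine Filter.Eventually.of_forall fun k => ?_
      refine (Set.indicator_of_notMem (fun h => hp (mem_pansuSet_iff.2 ?_)) _).symm
      have h1 : |p.2| ≤ g k p.1 := abs_le.2 ⟨h.1, h.2.le⟩
      have hpos : 0 < g k p.1 := by have := h.1.trans_lt h.2; linarith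
      have h3 : g k p.1 ≤ max (sqProfile (sqNorm p.1) - δ k) 0 := softThreshold_le (hδ k).le _
      have := hδ k
      rcases max_cases (sqProfile (sqNorm p.1) - δ k) 0 with h4 | h4 <;> linarith
  exact le_of_tendsto' hlim hbound

/-! ### The approximate calibration -/

/-- The parameter `a⁻² - 1` of the leaf through `(P, t)`, where `P` is the height of Pansu's set over
the given horizontal point and all leaves meet Pansu's sphere at height `c`. -/
def leafParam (c P t : ℝ) : ℝ := ((((P ^ 2 - c ^ 2) / (t - c) + (t - c)) / 2) ^ 2 - P ^ 2) / 4

/-- A cutoff that equals `0` for `t ≤ c + η / 4` and `1` for `t ≥ c + η / 2`. -/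
def leafCutoff (c η t : ℝ) : ℝ := Real.smoothTransition (4 * (t - c) / η - 1)

/-- The smoothed leaf parameter; it vanishes outside Pansu's set. -/
def tilt (c η δ P t : ℝ) : ℝ :=
  if t < P then leafCutoff c η t * softThreshold δ (leafParam c P t) else 0

/-- The curvature of the smoothed leaf through `(P, t)`, relative to that of Pansu's sphere. -/
def curvature (c η δ P t : ℝ) : ℝ := 1 / √(1 + tilt c η δ P t)

/-- A cutoff to a compact part of the open cylinder over the unit ball. -/
def cylinderCutoff (R δ P t : ℝ) : ℝ :=
  Real.smoothTransition (P / δ - 1) *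
    (Real.smoothTransition (R + 1 - t) * Real.smoothTransition (R + 1 + t))

/-- A smooth approximation of the sign of `t`. -/
def smoothSign (δ t : ℝ) : ℝ := Real.smoothTransition (t / δ) - Real.smoothTransition (-t / δ)

/-- The radial coefficient of the calibration. -/
def radialCoeff (c η R δ : ℝ) (p : Heisenberg n) : ℝ :=
  cylinderCutoff R δ (sqProfile (sqNorm p.1)) p.2 *
    curvature c η δ (sqProfile (sqNorm p.1)) p.2

/-- The angular coefficient of the calibration. -/
def angularCoeff (c η R δ : ℝ) (p : Heisenberg n) : ℝ :=
  cylinderCutoff R δ (sqProfile (sqNorm p.1)) p.2 * (smoothSign δ p.2 *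
    (√(1 - sqNorm p.1 * curvature c η δ (sqProfile (sqNorm p.1)) p.2 ^ 2) / √(sqNorm p.1 + δ)))

/-- The approximate calibration. -/
def calibration (c η R δ : ℝ) : Heisenberg n → EuclideanSpace ℝ (Fin n ⊕ Fin n) :=
  radialField (radialCoeff c η R δ) (angularCoeff c η R δ)

variable {c η R δ : ℝ}

/-! ### Regularity, support and norm of the calibration -/

lemma leafCutoff_nonneg (c η t : ℝ) : 0 ≤ leafCutoff c η t := Real.smoothTransition.nonneg _

lemma leafCutoff_eq_zero (hη : 0 < η) {t : ℝ} (h : t - c ≤ η / 4) : leafCutoff c η t = 0 := by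
  refine Real.smoothTransition.zero_of_nonpos ?_
  rw [sub_nonpos, div_le_one hη]
  linarith

lemma leafCutoff_eq_one (hη : 0 < η) {t : ℝ} (h : η / 2 ≤ t - c) : leafCutoff c η t = 1 := by
  refine Real.smoothTransition.one_of_one_le ?_
  rw [le_sub_iff_add_le, le_div_iff₀ hη]
  linarith

lemma tilt_nonneg (c η δ P t : ℝ) : 0 ≤ tilt c η δ P t := by
  unfold tilt
  split_ifs
  · exact mul_nonneg (leafCutoff_nonneg _ _ _) (softThreshold_nonneg _ _)
  · exact le_rfl

lemma tilt_of_le {P t : ℝ} (h : P ≤ t) : tilt c η δ P t = 0 := if_neg (not_lt.2 h)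

lemma tilt_of_sub_le (hη : 0 < η) {P t : ℝ} (h : t - c ≤ η / 4) : tilt c η δ P t = 0 := by
  unfold tilt
  rw [leafCutoff_eq_zero hη h, zero_mul, ite_self]

lemma leafParam_self {P : ℝ} (h : P - c ≠ 0) : leafParam c P P = 0 := by
  unfold leafParam
  field_simp
  ring

lemma contDiffAt_leafParam {q : ℝ × ℝ} (h : q.2 - c ≠ 0) :
    ContDiffAt ℝ 1 (fun q : ℝ × ℝ => leafParam c q.1 q.2) q := by
  unfold leafParam
  fun_prop (disch := exact h)

/-- The leaf parameter vanishes on t = P, hence is below δ nearby, where the threshold is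
identically zero. This removes the kink of the curvature across the upper hemisphere. -/
lemma eventually_tilt_eq_zero (hδ : 0 < δ) {q : ℝ × ℝ} (h : q.1 ≤ q.2) (hc : 0 < q.2 - c) :
    ∀ᶠ r : ℝ × ℝ in nhds q, tilt c η δ r.1 r.2 = 0 := by
  rcases h.lt_or_eq with h | h
  · filter_upwards [(isOpen_lt continuous_fst continuous_snd).mem_nhds h] with r hr
    exact tilt_of_le (le_of_lt hr)
  · have h0 : leafParam c q.1 q.2 < δ := by
      rw [← h, leafParam_self (by rw [h]; exact hc.ne')]; exact hδ
    filter_upwards [(contDiffAt_leafParam hc.ne').continuousAt.eventually_lt_const h0] with r hr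
    unfold tilt
    rw [softThreshold_of_le hδ.le hr.le, mul_zero, ite_self]

lemma contDiff_leafCutoff : ContDiff ℝ 1 (leafCutoff c η) := by
  unfold leafCutoff
  exact Real.smoothTransition.contDiff.comp (by fun_prop)

lemma contDiff_tilt (hη : 0 < η) (hδ : 0 < δ) :
    ContDiff ℝ 1 fun q : ℝ × ℝ => tilt c η δ q.1 q.2 := by
  rw [contDiff_iff_contDiffAt]
  intro q
  rcases lt_or_ge (q.2 - c) (η / 4) with h | h
  · refine (contDiffAt_const (c := (0 : ℝ))).congr_of_eventuallyEq ?_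
    have : ∀ᶠ r : ℝ × ℝ in nhds q, r.2 - c < η / 4 :=
      (by fun_prop : Continuous fun r : ℝ × ℝ => r.2 - c).continuousAt.eventually_lt_const h
    filter_upwards [this] with r hr using tilt_of_sub_le hη hr.le
  have hc : 0 < q.2 - c := by linarith
  rcases lt_or_ge q.2 q.1 with h1 | h1
  · have he : (fun q : ℝ × ℝ => tilt c η δ q.1 q.2) =ᶠ[nhds q]
        fun q => leafCutoff c η q.2 * softThreshold δ (leafParam c q.1 q.2) := by
      filter_upwards [(isOpen_lt continuous_snd continuous_fst).mem_nhds h1] with r hr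
      exact if_pos hr
    refine ContDiffAt.congr_of_eventuallyEq ?_ he
    exact (contDiff_leafCutoff.contDiffAt.comp q contDiffAt_snd).mul
      ((contDiff_softThreshold hδ).contDiffAt.comp q (contDiffAt_leafParam hc.ne'))
  · exact (contDiffAt_const (c := (0 : ℝ))).congr_of_eventuallyEq
      (eventually_tilt_eq_zero hδ h1 hc)

lemma curvature_pos (c η δ P t : ℝ) : 0 < curvature c η δ P t :=
  one_div_pos.2 (Real.sqrt_pos.2 (by linarith [tilt_nonneg c η δ P t]))

lemma curvature_le_one (c η δ P t : ℝ) : curvature c η δ P t ≤ 1 := by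
  have : 1 ≤ √(1 + tilt c η δ P t) := Real.one_le_sqrt.2 (by linarith [tilt_nonneg c η δ P t])
  exact div_le_one_of_le₀ this (by linarith)

lemma curvature_of_tilt_eq_zero {P t : ℝ} (h : tilt c η δ P t = 0) : curvature c η δ P t = 1 := by
  simp [curvature, h]

lemma contDiff_curvature (hη : 0 < η) (hδ : 0 < δ) :
    ContDiff ℝ 1 fun q : ℝ × ℝ => curvature c η δ q.1 q.2 := by
  have hpos : ∀ q : ℝ × ℝ, 0 < 1 + tilt c η δ q.1 q.2 := fun q => by
    linarith [tilt_nonneg c η δ q.1 q.2]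
  exact contDiff_const.div ((contDiff_const.add (contDiff_tilt hη hδ)).sqrt fun q => (hpos q).ne')
    fun q => (Real.sqrt_pos.2 (hpos q)).ne'

lemma sqNorm_mul_curvature_sq_lt {z : Fin n → ℂ} (hz : sqNorm z < 1) (c η δ P t : ℝ) :
    0 < 1 - sqNorm z * curvature c η δ P t ^ 2 := by
  have h1 := curvature_pos c η δ P t
  have h2 := curvature_le_one c η δ P t
  have h3 : curvature c η δ P t ^ 2 ≤ 1 := pow_le_one₀ h1.le h2
  nlinarith [sqNorm_nonneg z]

lemma cylinderCutoff_nonneg (R δ P t : ℝ) : 0 ≤ cylinderCutoff R δ P t :=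
  mul_nonneg (Real.smoothTransition.nonneg _)
    (mul_nonneg (Real.smoothTransition.nonneg _) (Real.smoothTransition.nonneg _))

lemma cylinderCutoff_le_one (R δ P t : ℝ) : cylinderCutoff R δ P t ≤ 1 :=
  mul_le_one₀ (Real.smoothTransition.le_one _)
    (mul_nonneg (Real.smoothTransition.nonneg _) (Real.smoothTransition.nonneg _))
    (mul_le_one₀ (Real.smoothTransition.le_one _) (Real.smoothTransition.nonneg _)
      (Real.smoothTransition.le_one _))

lemma cylinderCutoff_of_abs_le {P t : ℝ} (h : |t| ≤ R) :
    cylinderCutoff R δ P t = Real.smoothTransition (P / δ - 1) := by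
  have := abs_le.1 h
  rw [cylinderCutoff, Real.smoothTransition.one_of_one_le (x := R + 1 - t) (by linarith),
    Real.smoothTransition.one_of_one_le (x := R + 1 + t) (by linarith), one_mul, mul_one]

lemma cylinderCutoff_eq_zero (hδ : 0 < δ) {P t : ℝ} (h : P ≤ δ) : cylinderCutoff R δ P t = 0 := by
  have : P / δ ≤ 1 := (div_le_one hδ).2 h
  rw [cylinderCutoff, Real.smoothTransition.zero_of_nonpos (by linarith), zero_mul]

lemma cylinderCutoff_eq_zero_of_abs {P t : ℝ} (h : R + 1 ≤ |t|) : cylinderCutoff R δ P t = 0 := by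
  rcases le_abs.1 h with h | h
  · rw [cylinderCutoff, Real.smoothTransition.zero_of_nonpos (x := R + 1 - t) (by linarith)]
    simp
  · rw [cylinderCutoff, Real.smoothTransition.zero_of_nonpos (x := R + 1 + t) (by linarith)]
    simp

lemma cylinderCutoff_eq_one (hδ : 0 < δ) {P t : ℝ} (hP : 2 * δ ≤ P) (h : |t| ≤ R) :
    cylinderCutoff R δ P t = 1 := by
  have : 2 ≤ P / δ := (le_div_iff₀ hδ).2 hP
  rw [cylinderCutoff_of_abs_le h, Real.smoothTransition.one_of_one_le (by linarith)]

lemma contDiff_cylinderCutoff : ContDiff ℝ 1 fun q : ℝ × ℝ => cylinderCutoff R δ q.1 q.2 := by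
  unfold cylinderCutoff
  refine ContDiff.mul (Real.smoothTransition.contDiff.comp (by fun_prop))
    (ContDiff.mul (Real.smoothTransition.contDiff.comp (by fun_prop))
      (Real.smoothTransition.contDiff.comp (by fun_prop)))

lemma contDiff_smoothSign : ContDiff ℝ 1 (smoothSign δ) := by
  unfold smoothSign
  exact (Real.smoothTransition.contDiff.comp (by fun_prop)).sub
    (Real.smoothTransition.contDiff.comp (by fun_prop))

lemma abs_smoothSign_le_one (δ t : ℝ) : |smoothSign δ t| ≤ 1 := by
  have h1 := Real.smoothTransition.nonneg (t / δ)
  have h2 := Real.smoothTransition.le_one (t / δ)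
  have h3 := Real.smoothTransition.nonneg (-t / δ)
  have h4 := Real.smoothTransition.le_one (-t / δ)
  rw [smoothSign, abs_le]
  constructor <;> linarith

lemma smoothSign_of_le (hδ : 0 < δ) {t : ℝ} (h : δ ≤ t) : smoothSign δ t = 1 := by
  rw [smoothSign, Real.smoothTransition.one_of_one_le ((one_le_div hδ).2 h),
    Real.smoothTransition.zero_of_nonpos (div_nonpos_of_nonpos_of_nonneg (by linarith) hδ.le),
    sub_zero]

lemma smoothSign_neg (δ t : ℝ) : smoothSign δ (-t) = -smoothSign δ t := by
  rw [smoothSign, smoothSign, neg_neg]; ring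

/-- The height is below δ near any point with |z| ≥ 1, so regularity only has to be checked inside
the open cylinder, where the profile and √(1 - |z|² a²) are C¹. -/
lemma contDiff_of_cylinder (hδ : 0 < δ) {f : Heisenberg n → ℝ}
    (h1 : ∀ p : Heisenberg n, sqNorm p.1 < 1 → ContDiffAt ℝ 1 f p)
    (h0 : ∀ p : Heisenberg n, sqProfile (sqNorm p.1) ≤ δ → f p = 0) : ContDiff ℝ 1 f := by
  rw [contDiff_iff_contDiffAt]
  intro p
  rcases lt_or_ge (sqNorm p.1) 1 with hz | hz
  · exact h1 p hz
  · refine (contDiffAt_const (c := (0 : ℝ))).congr_of_eventuallyEq ?_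
    have : ∀ᶠ q : Heisenberg n in nhds p, sqProfile (sqNorm q.1) < δ :=
      (continuous_sqProfile.comp (continuous_sqNorm.comp
        continuous_fst)).continuousAt.eventually_lt_const
        (by simpa [sqProfile_of_one_le hz] using hδ)
    filter_upwards [this] with q hq using h0 q hq.le

lemma contDiffAt_height {p : Heisenberg n} (hp : sqNorm p.1 < 1) :
    ContDiffAt ℝ 1 (fun p : Heisenberg n => (sqProfile (sqNorm p.1), p.2)) p := by
  refine ContDiffAt.prodMk ?_ contDiffAt_snd
  exact ContDiffAt.comp p (g := sqProfile) (contDiffAt_sqProfile hp)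
    (contDiff_sqNorm.comp contDiff_fst).contDiffAt

lemma contDiff_radialCoeff (hη : 0 < η) (hδ : 0 < δ) :
    ContDiff ℝ 1 (radialCoeff c η R δ : Heisenberg n → ℝ) := by
  refine contDiff_of_cylinder hδ (fun p hp => ?_) fun p hp => ?_
  · have h := contDiffAt_height hp
    exact ((contDiff_cylinderCutoff (R := R) (δ := δ)).contDiffAt.comp p h).mul
      ((contDiff_curvature (c := c) hη hδ).contDiffAt.comp p h)
  · rw [radialCoeff, cylinderCutoff_eq_zero hδ hp, zero_mul]

lemma contDiff_angularCoeff (hη : 0 < η) (hδ : 0 < δ) :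
    ContDiff ℝ 1 (angularCoeff c η R δ : Heisenberg n → ℝ) := by
  refine contDiff_of_cylinder hδ (fun p hp => ?_) fun p hp => ?_
  · have h := contDiffAt_height hp
    have hN : ContDiffAt ℝ 1 (fun p : Heisenberg n => sqNorm p.1) p :=
      (contDiff_sqNorm.comp contDiff_fst).contDiffAt
    have hpos : 0 < sqNorm p.1 + δ := by linarith [sqNorm_nonneg p.1]
    refine ((contDiff_cylinderCutoff (R := R) (δ := δ)).contDiffAt.comp p h).mul
      (((contDiff_smoothSign (δ := δ)).contDiffAt.comp p contDiffAt_snd).mul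
        (ContDiffAt.div (ContDiffAt.sqrt (contDiffAt_const.sub (hN.mul
          (((contDiff_curvature (c := c) hη hδ).contDiffAt.comp p h).pow 2)))
          (sqNorm_mul_curvature_sq_lt hp _ _ _ _ _).ne')
          ((hN.add contDiffAt_const).sqrt hpos.ne') (Real.sqrt_pos.2 hpos).ne'))
  · rw [angularCoeff, cylinderCutoff_eq_zero hδ hp, zero_mul]

lemma contDiff_calibration (hη : 0 < η) (hδ : 0 < δ) :
    ContDiff ℝ 1 (calibration c η R δ : Heisenberg n → _) :=
  contDiff_radialField (contDiff_radialCoeff hη hδ) (contDiff_angularCoeff hη hδ)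

lemma calibration_eq_zero {p : Heisenberg n}
    (h : cylinderCutoff R δ (sqProfile (sqNorm p.1)) p.2 = 0) : calibration c η R δ p = 0 := by
  ext (j | j) <;> simp [calibration, radialField, radialCoeff, angularCoeff, h]

lemma hasCompactSupport_calibration (hR : 0 ≤ R) (hδ : 0 < δ) :
    HasCompactSupport (calibration c η R δ : Heisenberg n → _) := by
  refine HasCompactSupport.intro (isCompact_closedBall (0 : Heisenberg n) (R + 1)) fun p hp => ?_
  refine calibration_eq_zero ?_
  by_contra hne
  refine hp ?_
  have h1 : sqNorm p.1 < 1 := by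
    rw [← sqProfile_pos_iff]
    by_contra h
    exact hne (cylinderCutoff_eq_zero hδ (by linarith))
  have h2 : |p.2| < R + 1 := by
    by_contra h
    exact hne (cylinderCutoff_eq_zero_of_abs (not_lt.1 h))
  rw [mem_closedBall_zero_iff, Prod.norm_def, max_le_iff]
  exact ⟨norm_le_of_sqNorm_le (by linarith) (by nlinarith), h2.le⟩

/-- With cutoff k and smoothed sign σ, the squared norm is k² (N a² + σ² (1 - N a²) N / (N + δ)),
and k², σ² and N / (N + δ) are all at most 1. -/
lemma norm_calibration_le (hδ : 0 < δ) (p : Heisenberg n) : ‖calibration c η R δ p‖ ≤ 1 := by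
  rcases lt_or_ge (sqNorm p.1) 1 with hp | hp
  · rw [← sq_le_one_iff₀ (norm_nonneg _), calibration, norm_sq_radialField, radialCoeff,
      angularCoeff]
    set a := curvature c η δ (sqProfile (sqNorm p.1)) p.2
    set k := cylinderCutoff R δ (sqProfile (sqNorm p.1)) p.2
    set N := sqNorm p.1
    have hN : 0 ≤ N := sqNorm_nonneg p.1
    have hk : k ^ 2 ≤ 1 := pow_le_one₀ (cylinderCutoff_nonneg _ _ _ _) (cylinderCutoff_le_one _ _ _ _)
    have hs : smoothSign δ p.2 ^ 2 ≤ 1 := (sq_le_one_iff_abs_le_one _).2 (abs_smoothSign_le_one _ _)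
    have ha : 0 < 1 - N * a ^ 2 := sqNorm_mul_curvature_sq_lt hp _ _ _ _ _
    have hNδ : 0 < N + δ := by linarith
    rw [mul_pow, mul_pow, mul_pow, div_pow, Real.sq_sqrt ha.le, Real.sq_sqrt hNδ.le]
    have h1 : N * (smoothSign δ p.2 ^ 2 * ((1 - N * a ^ 2) / (N + δ))) ≤ 1 - N * a ^ 2 := by
      have : N / (N + δ) ≤ 1 := (div_le_one hNδ).2 (by linarith)
      calc N * (smoothSign δ p.2 ^ 2 * ((1 - N * a ^ 2) / (N + δ)))
          = (smoothSign δ p.2 ^ 2 * (N / (N + δ))) * (1 - N * a ^ 2) := by ring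
        _ ≤ 1 * (1 - N * a ^ 2) := by
          refine mul_le_mul_of_nonneg_right (mul_le_one₀ hs (by positivity) this) ha.le
        _ = _ := one_mul _
    calc N * (k ^ 2 * a ^ 2 + k ^ 2 * (smoothSign δ p.2 ^ 2 * ((1 - N * a ^ 2) / (N + δ))))
        = k ^ 2 * (N * a ^ 2 + N * (smoothSign δ p.2 ^ 2 * ((1 - N * a ^ 2) / (N + δ)))) := by ring
      _ ≤ 1 * 1 := by
        refine mul_le_mul hk (by linarith) ?_ one_pos.le
        positivity
      _ = 1 := one_mul 1
  · rw [calibration_eq_zero (cylinderCutoff_eq_zero hδ (by rw [sqProfile_of_one_le hp]; exact hδ.le)),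
      norm_zero]
    exact zero_le_one

lemma calibration_mem_testFields (hη : 0 < η) (hR : 0 ≤ R) (hδ : 0 < δ) :
    (calibration c η R δ : Heisenberg n → _) ∈ testFields Set.univ :=
  ⟨contDiff_calibration hη hδ, hasCompactSupport_calibration hR hδ, Set.subset_univ _,
    norm_calibration_le hδ⟩

/-! ### The divergence of the approximate calibration -/

lemma fderiv_apply_eq_of_line {f : Heisenberg n → ℝ} {p v : Heisenberg n} {d : ℝ}
    (hf : DifferentiableAt ℝ f p) (h : HasDerivAt (fun s : ℝ => f (p + s • v)) d 0) :
    fderiv ℝ f p v = d :=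
  (hf.hasFDerivAt.hasLineDerivAt v : HasDerivAt _ _ _).unique h

lemma hasDerivAt_line (p v : Heisenberg n) : HasDerivAt (fun s : ℝ => p + s • v) v 0 := by
  simpa using ((hasDerivAt_id (0 : ℝ)).smul_const v).const_add p

lemma hasDerivAt_sqNorm_line (p v : Heisenberg n) :
    HasDerivAt (fun s : ℝ => sqNorm (p + s • v).1) (sqNormDeriv p.1 v.1) 0 := by
  have h : HasFDerivAt (fun q : Heisenberg n => sqNorm q.1)
      ((sqNormDeriv p.1).comp (ContinuousLinearMap.fst ℝ _ _)) p :=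
    (hasFDerivAt_sqNorm p.1).comp p hasFDerivAt_fst
  exact h.hasLineDerivAt v

lemma hasDerivAt_snd_line (p v : Heisenberg n) :
    HasDerivAt (fun s : ℝ => (p + s • v).2) v.2 0 :=
  (hasFDerivAt_snd (𝕜 := ℝ) (p := p)).hasLineDerivAt v

lemma hasDerivAt_height_line {p : Heisenberg n} (hp : sqNorm p.1 < 1) (v : Heisenberg n) :
    HasDerivAt (fun s : ℝ => sqProfile (sqNorm (p + s • v).1))
      (-√(sqNorm p.1) / √(1 - sqNorm p.1) * sqNormDeriv p.1 v.1) 0 := by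
  have h := hasDerivAt_sqNorm_line p v
  have h0 : sqNorm (p + (0 : ℝ) • v).1 = sqNorm p.1 := by simp
  exact HasDerivAt.comp (h₂ := sqProfile) (0 : ℝ) (by rw [h0]; exact hasDerivAt_sqProfile hp) h

/-- The factored form exhibits the slope of the leaves: with X = ((P² - c²) / (t - c) + (t - c)) /
2, motion along a leaf satisfies P dP = X dt. -/
lemma hasDerivAt_leafParam {P t : ℝ → ℝ} {P' t' s : ℝ} (hP : HasDerivAt P P' s)
    (ht : HasDerivAt t t' s) (hT : t s - c ≠ 0) :
    HasDerivAt (fun s => leafParam c (P s) (t s))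
      (((P s ^ 2 - c ^ 2) / (t s - c) - (t s - c)) / (4 * (t s - c)) *
        (P s * P' - ((P s ^ 2 - c ^ 2) / (t s - c) + (t s - c)) / 2 * t')) s := by
  have hT' := ht.sub_const c
  have hD := (hP.pow 2).sub_const (c ^ 2)
  refine ((((((hD.div hT' hT).add hT').div_const 2).pow 2).sub (hP.pow 2)).div_const 4).congr_deriv ?_
  simp only [Pi.add_apply, Pi.div_apply, Pi.pow_apply, Nat.cast_ofNat, Nat.add_one_sub_one, pow_one]
  generalize t s - c = T at *
  field_simp
  ring

/-- The points of the cylinder at which all cutoffs are inactive. -/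
structure IsUncut (c η R δ : ℝ) (p : Heisenberg n) : Prop where
  height : 2 * δ < sqProfile (sqNorm p.1)
  bounded : |p.2| < R
  sign : δ < p.2
  leaf : η ≤ p.2 - c

lemma IsUncut.sqNorm_lt {p : Heisenberg n} (h : IsUncut c η R δ p) (hδ : 0 < δ) :
    sqNorm p.1 < 1 := by
  rw [← sqProfile_pos_iff]
  linarith [h.height]

lemma continuous_height : Continuous fun p : Heisenberg n => sqProfile (sqNorm p.1) :=
  continuous_sqProfile.comp (continuous_sqNorm.comp continuous_fst)

lemma IsUncut.eventually_coeff {p : Heisenberg n} (h : IsUncut c η R δ p) (hδ : 0 < δ) :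
    ∀ᶠ q : Heisenberg n in nhds p,
      radialCoeff c η R δ q = curvature c η δ (sqProfile (sqNorm q.1)) q.2 ∧
      angularCoeff c η R δ q = √(1 - sqNorm q.1 * radialCoeff c η R δ q ^ 2) / √(sqNorm q.1 + δ) := by
  have h1 := continuous_height.continuousAt.eventually_const_lt h.height
  have h2 := (by fun_prop : Continuous fun q : Heisenberg n => |q.2|).continuousAt.eventually_lt_const
    h.bounded
  have h3 := (continuous_snd (X := Fin n → ℂ) (Y := ℝ)).continuousAt.eventually_const_lt h.sign
  filter_upwards [h1, h2, h3] with q h1 h2 h3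
  have hr : radialCoeff c η R δ q = curvature c η δ (sqProfile (sqNorm q.1)) q.2 := by
    rw [radialCoeff, cylinderCutoff_eq_one hδ h1.le h2.le, one_mul]
  refine ⟨hr, ?_⟩
  rw [hr, angularCoeff, cylinderCutoff_eq_one hδ h1.le h2.le, smoothSign_of_le hδ h3.le, one_mul,
    one_mul]

lemma tendsto_line (p v : Heisenberg n) :
    Filter.Tendsto (fun s : ℝ => p + s • v) (nhds 0) (nhds p) := by
  have := (hasDerivAt_line p v).continuousAt.tendsto
  simpa using this

/-- If the radial coefficient has derivative `d` in a direction tangent to the level sets of the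
horizontal radius, this is the derivative of the angular coefficient. -/
lemma IsUncut.fderiv_angularCoeff {p : Heisenberg n} (h : IsUncut c η R δ p) (hη : 0 < η)
    (hδ : 0 < δ) {v : Heisenberg n} (hv : sqNormDeriv p.1 v.1 = 0) :
    fderiv ℝ (angularCoeff c η R δ) p v = -(sqNorm p.1 * radialCoeff c η R δ p *
      fderiv ℝ (radialCoeff c η R δ) p v) /
      (√(1 - sqNorm p.1 * radialCoeff c η R δ p ^ 2) * √(sqNorm p.1 + δ)) := by
  refine fderiv_apply_eq_of_line ((contDiff_angularCoeff hη hδ).differentiable one_ne_zero p) ?_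
  have hev := (tendsto_line p v).eventually (h.eventually_coeff hδ)
  refine HasDerivAt.congr_of_eventuallyEq ?_ (hev.mono fun s hs => hs.2)
  have hA : HasDerivAt (fun s : ℝ => radialCoeff c η R δ (p + s • v))
      (fderiv ℝ (radialCoeff c η R δ) p v) 0 :=
    ((contDiff_radialCoeff hη hδ).differentiable one_ne_zero p).hasFDerivAt.hasLineDerivAt v
  have hN := hasDerivAt_sqNorm_line p v
  rw [hv] at hN
  have hp := h.sqNorm_lt hδ
  have hpos : 0 < 1 - sqNorm p.1 * radialCoeff c η R δ p ^ 2 := by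
    rw [(h.eventually_coeff hδ).self_of_nhds.1]
    exact sqNorm_mul_curvature_sq_lt hp _ _ _ _ _
  have hNδ : 0 < sqNorm p.1 + δ := by linarith [sqNorm_nonneg p.1]
  have hs1 := Real.sqrt_pos.2 hpos
  have hs2 := Real.sqrt_pos.2 hNδ
  have hmain := (((hN.mul (hA.pow 2)).const_sub 1).sqrt (by simpa using hpos.ne')).div
    ((hN.add_const δ).sqrt (by simpa using hNδ.ne')) (by simpa using hs2.ne')
  refine hmain.congr_deriv ?_
  simp only [Pi.mul_apply, Pi.pow_apply, zero_smul, add_zero]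
  field_simp
  ring

/-- B is differentiated only along (-iz, 2|z|²), where |z| is stationary, so its derivative is
expressed through that of A. -/
lemma IsUncut.divH_eq {p : Heisenberg n} (h : IsUncut c η R δ p) (hη : 0 < η) (hδ : 0 < δ) :
    divH (calibration c η R δ) p = 2 * n * radialCoeff c η R δ p +
      (fderiv ℝ (radialCoeff c η R δ) p (p.1, 0) -
        sqNorm p.1 * radialCoeff c η R δ p *
          fderiv ℝ (radialCoeff c η R δ) p (fun j => -Complex.I * p.1 j, 2 * sqNorm p.1) /
        (√(1 - sqNorm p.1 * radialCoeff c η R δ p ^ 2) * √(sqNorm p.1 + δ))) := by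
  rw [calibration, divH_radialField ((contDiff_radialCoeff hη hδ).differentiable one_ne_zero p)
    ((contDiff_angularCoeff hη hδ).differentiable one_ne_zero p),
    h.fderiv_angularCoeff hη hδ (sqNormDeriv_rotate p.1), neg_div]
  ring

/-- Outside Pansu's set the leaves are vertical translates of its upper hemisphere. -/
lemma IsUncut.divH_outside {p : Heisenberg n} (h : IsUncut c η R δ p) (hη : 0 < η) (hδ : 0 < δ)
    (hout : sqProfile (sqNorm p.1) ≤ p.2) : divH (calibration c η R δ) p = 2 * n := by
  have hcont : Continuous fun q : Heisenberg n => (sqProfile (sqNorm q.1), q.2) :=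
    continuous_height.prodMk continuous_snd
  have hT : 0 < p.2 - c := by linarith [h.leaf]
  have ht := hcont.continuousAt.eventually
    (eventually_tilt_eq_zero (c := c) (η := η) hδ (q := (sqProfile (sqNorm p.1), p.2)) hout hT)
  have he : (radialCoeff c η R δ : Heisenberg n → ℝ) =ᶠ[nhds p] fun _ => 1 := by
    filter_upwards [h.eventually_coeff hδ, ht] with q h1 h2
    rw [h1.1, curvature_of_tilt_eq_zero h2]
  have hf : fderiv ℝ (radialCoeff c η R δ : Heisenberg n → ℝ) p = 0 := by
    rw [he.fderiv_eq]; simp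
  rw [h.divH_eq hη hδ, hf, he.eq_of_nhds]
  simp

lemma curvature_eq (hη : 0 < η) {P t : ℝ} (ht : t < P) (hT : η ≤ t - c) :
    curvature c η δ P t = 1 / √(1 + softThreshold δ (leafParam c P t)) := by
  rw [curvature, tilt, if_pos ht, leafCutoff_eq_one hη (by linarith), one_mul]

lemma IsUncut.fderiv_radialCoeff {p : Heisenberg n} (h : IsUncut c η R δ p) (hη : 0 < η)
    (hδ : 0 < δ) (hin : p.2 < sqProfile (sqNorm p.1)) (hT : η < p.2 - c) (v : Heisenberg n) :
    fderiv ℝ (radialCoeff c η R δ) p v =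
      softThresholdDeriv δ (leafParam c (sqProfile (sqNorm p.1)) p.2) /
        (2 * (1 + softThreshold δ (leafParam c (sqProfile (sqNorm p.1)) p.2)) *
          √(1 + softThreshold δ (leafParam c (sqProfile (sqNorm p.1)) p.2))) *
      (((sqProfile (sqNorm p.1) ^ 2 - c ^ 2) / (p.2 - c) - (p.2 - c)) / (4 * (p.2 - c))) *
      (((sqProfile (sqNorm p.1) ^ 2 - c ^ 2) / (p.2 - c) + (p.2 - c)) / 2 * v.2 +
        sqProfile (sqNorm p.1) *
          (√(sqNorm p.1) / √(1 - sqNorm p.1) * sqNormDeriv p.1 v.1)) := by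
  refine fderiv_apply_eq_of_line ((contDiff_radialCoeff hη hδ).differentiable one_ne_zero p) ?_
  have hp := h.sqNorm_lt hδ
  have e1 : ∀ᶠ q : Heisenberg n in nhds p, q.2 < sqProfile (sqNorm q.1) :=
    (isOpen_lt continuous_snd continuous_height).mem_nhds hin
  have e2 : ∀ᶠ q : Heisenberg n in nhds p, η < q.2 - c :=
    (by fun_prop : Continuous fun q : Heisenberg n => q.2 - c).continuousAt.eventually_const_lt hT
  have hev := (tendsto_line p v).eventually ((h.eventually_coeff hδ).and (e1.and e2))
  refine HasDerivAt.congr_of_eventuallyEq (f := fun s : ℝ => 1 / √(1 + softThreshold δ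
    (leafParam c (sqProfile (sqNorm (p + s • v).1)) (p + s • v).2))) ?_
    (hev.mono fun s hs => hs.1.1.trans (curvature_eq hη hs.2.1 hs.2.2.le))
  have hU := hasDerivAt_leafParam (c := c) (hasDerivAt_height_line hp v) (hasDerivAt_snd_line p v)
    (by simp; linarith)
  have hκ := HasDerivAt.comp (0 : ℝ) (hasDerivAt_softThreshold hδ _) hU
  have hpos : 0 < 1 + softThreshold δ (leafParam c (sqProfile (sqNorm p.1)) p.2) := by
    linarith [softThreshold_nonneg δ (leafParam c (sqProfile (sqNorm p.1)) p.2)]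
  have hs := Real.sqrt_pos.2 hpos
  have hmain := ((hκ.const_add 1).sqrt (by simpa using hpos.ne')).inv (by simpa using hs.ne')
  simp only [one_div]
  refine hmain.congr_deriv ?_
  simp only [Function.comp, zero_smul, add_zero, Real.sq_sqrt hpos.le]
  have hTne : p.2 - c ≠ 0 := by linarith
  field_simp
  ring

/-- The key inequality: the level sets of the leaf parameter are less steep than the surfaces of
constant horizontal curvature. -/
lemma slope_comparison {N P t : ℝ} (h1 : N < 1) (hP : 0 < P) (hPN : P ≤ 2 * √(1 - N))
    (hc : 0 ≤ c) (ht : c < t) (htP : t < P) {Υ : ℝ} (hΥ0 : 0 ≤ Υ)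
    (hΥ : Υ ≤ max (leafParam c P t) 0) :
    P / √(1 - N) ≤ ((P ^ 2 - c ^ 2) / (t - c) + (t - c)) / 2 / √(1 + Υ - N) := by
  set X := ((P ^ 2 - c ^ 2) / (t - c) + (t - c)) / 2 with hX
  have hT : 0 < t - c := by linarith
  have hD : 0 < P ^ 2 - c ^ 2 := by nlinarith
  have hX0 : 0 < X := by positivity
  have hw : 0 < 1 - N := by linarith
  have hw' : 0 < 1 + Υ - N := by linarith
  have hXP : P ≤ X := by
    have : X - P = ((P - (t - c)) ^ 2 - c ^ 2) / (2 * (t - c)) := by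
      rw [hX]; field_simp; ring
    have h2 : 0 ≤ ((P - (t - c)) ^ 2 - c ^ 2) / (2 * (t - c)) :=
      div_nonneg (by nlinarith) (by linarith)
    linarith
  have hU : leafParam c P t = (X ^ 2 - P ^ 2) / 4 := rfl
  have hU0 : 0 ≤ leafParam c P t := by rw [hU]; nlinarith
  rw [max_eq_left hU0, hU] at hΥ
  -- After squaring, and since X² - P² = 4U with U = `leafParam c P t`, the claim is P² Υ ≤ 4U (1 -
  -- N). It follows from P² ≤ 4 (1 - N) and Υ ≤ U.
  have hP4 : P ^ 2 ≤ 4 * (1 - N) := by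
    have := pow_le_pow_left₀ hP.le hPN 2
    rw [mul_pow, Real.sq_sqrt hw.le] at this
    linarith
  rw [div_le_div_iff₀ (Real.sqrt_pos.2 hw) (Real.sqrt_pos.2 hw')]
  refine le_of_sq_le_sq ?_ (by positivity)
  rw [mul_pow, mul_pow, Real.sq_sqrt hw.le, Real.sq_sqrt hw'.le]
  have h3 : P ^ 2 * Υ ≤ 4 * (1 - N) * ((X ^ 2 - P ^ 2) / 4) :=
    mul_le_mul hP4 hΥ hΥ0 (by linarith)
  nlinarith

/-- The cost of replacing 1 / |z| by 1 / √(|z|² + δ): the prefactor N makes it O(δ) uniformly up to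
the axis. -/
lemma mul_one_sub_div_sqrt_le {N : ℝ} (h0 : 0 ≤ N) (hδ : 0 < δ) :
    N * (1 - √N / √(N + δ)) ≤ δ := by
  have hpos : 0 < N + δ := by linarith
  have h1 : √N / √(N + δ) ≥ N / (N + δ) := by
    rw [← Real.sqrt_div h0]
    have hq0 : 0 ≤ N / (N + δ) := by positivity
    have hq1 : N / (N + δ) ≤ 1 := (div_le_one hpos).2 (by linarith)
    exact Real.le_sqrt_of_sq_le (by nlinarith)
  have h2 : N * (1 - N / (N + δ)) ≤ δ := by
    have : N * (1 - N / (N + δ)) = δ * (N / (N + δ)) := by field_simp; ring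
    rw [this]
    exact mul_le_of_le_one_right hδ.le ((div_le_one hpos).2 (by linarith))
  nlinarith

/-- Inside Pansu's set the divergence is controlled by the curvature of the leaves. -/
lemma IsUncut.divH_inside {p : Heisenberg n} (h : IsUncut c η R δ p) (hη : 0 < η) (hδ : 0 < δ)
    (hc : 0 ≤ c) (hin : p.2 < sqProfile (sqNorm p.1)) (hT : η < p.2 - c) :
    divH (calibration c η R δ) p ≤ 2 * n * radialCoeff c η R δ p + 2 * δ / η ^ 2 := by
  rw [h.divH_eq hη hδ, add_le_add_iff_left, h.fderiv_radialCoeff hη hδ hin hT,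
    h.fderiv_radialCoeff hη hδ hin hT, sqNormDeriv_rotate, sqNormDeriv_self,
    (h.eventually_coeff hδ).self_of_nhds.1, curvature_eq hη hin h.leaf]
  have hN1 := h.sqNorm_lt hδ
  have hN0 := sqNorm_nonneg p.1
  have hPle := sqProfile_le hN0
  have hP2 := sqProfile_le_two hN0
  have hP0 : 0 < sqProfile (sqNorm p.1) := sqProfile_pos_iff.2 hN1
  generalize hP : sqProfile (sqNorm p.1) = P at *
  generalize sqNorm p.1 = N at *
  generalize p.2 = t at *
  have hΥ0 := softThreshold_nonneg δ (leafParam c P t)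
  have hΥU : softThreshold δ (leafParam c P t) ≤ max (leafParam c P t) 0 :=
    (softThreshold_le hδ.le _).trans (max_le_max (by linarith) le_rfl)
  have hcmp := slope_comparison hN1 hP0 hPle hc (by linarith) hin hΥ0 hΥU
  have hκ0 := softThresholdDeriv_nonneg δ (leafParam c P t)
  have hκ1 := softThresholdDeriv_le_one δ (leafParam c P t)
  generalize softThreshold δ (leafParam c P t) = Υ at *
  generalize softThresholdDeriv δ (leafParam c P t) = κ at *
  have hT0 : 0 < t - c := by linarith
  generalize hTdef : t - c = T at *
  set X := ((P ^ 2 - c ^ 2) / T + T) / 2 with hX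
  have h1Υ : 0 < 1 + Υ := by linarith
  have hw : 0 < 1 - N := by linarith
  have hw' : 0 < 1 + Υ - N := by linarith
  have hNδ : 0 < N + δ := by linarith
  set K := κ / (2 * (1 + Υ) * √(1 + Υ)) with hK
  have hK0 : 0 ≤ K := by positivity
  have hK1 : K ≤ 1 / 2 := by
    have h1 : 1 ≤ √(1 + Υ) := Real.one_le_sqrt.2 (by linarith)
    rw [hK, div_le_iff₀ (by positivity)]
    nlinarith
  set Y := ((P ^ 2 - c ^ 2) / T - T) / (4 * T) with hY
  have hY0 : 0 ≤ Y := by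
    refine div_nonneg ?_ (by linarith)
    rw [sub_nonneg, le_div_iff₀ hT0]
    nlinarith
  have hY1 : Y ≤ 1 / η ^ 2 := by
    have : Y ≤ P ^ 2 / (4 * T ^ 2) := by
      rw [hY, show P ^ 2 / (4 * T ^ 2) = (P ^ 2 / T) / (4 * T) by field_simp]
      refine div_le_div_of_nonneg_right ?_ (by linarith)
      have : (P ^ 2 - c ^ 2) / T ≤ P ^ 2 / T :=
        div_le_div_of_nonneg_right (by nlinarith) hT0.le
      linarith
    refine this.trans ?_
    rw [div_le_div_iff₀ (by positivity) (by positivity)]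
    have : η ^ 2 ≤ T ^ 2 := pow_le_pow_left₀ hη.le hT.le 2
    have : P ^ 2 ≤ 4 := by nlinarith
    nlinarith [sq_nonneg η]
  have hsq : √(1 - N * (1 / √(1 + Υ)) ^ 2) = √(1 + Υ - N) / √(1 + Υ) := by
    rw [← Real.sqrt_div hw'.le, div_pow, Real.sq_sqrt h1Υ.le]
    congr 1
    field_simp
  have hs1 := Real.sqrt_pos.2 h1Υ
  have hs2 := Real.sqrt_pos.2 hw
  have hs3 := Real.sqrt_pos.2 hw'
  have hs4 := Real.sqrt_pos.2 hNδ
  rw [hsq]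
  -- Both derivatives share the nonnegative factor 2NKY. For δ = 0 and N > 0 the bracket is √N times
  -- the difference of the two sides of `slope_comparison`, hence nonpositive; for δ > 0 only the
  -- regularisation loss at the axis remains.
  have e : K * Y * (X * 0 + P * (√N / √(1 - N) * (2 * N))) -
      N * (1 / √(1 + Υ)) * (K * Y * (X * (2 * N) + P * (√N / √(1 - N) * 0))) /
        (√(1 + Υ - N) / √(1 + Υ) * √(N + δ)) =
      K * Y * (2 * N) * (P / √(1 - N) * √N - X / √(1 + Υ - N) * (N / √(N + δ))) := by
    field_simp
    ring
  rw [e]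
  have hNs : N = √N * √N := (Real.mul_self_sqrt hN0).symm
  have hsN : √N ≤ 1 := Real.sqrt_le_one.2 hN1.le
  have hPw : P / √(1 - N) ≤ 2 := (div_le_iff₀ hs2).2 hPle
  have hPw0 : 0 ≤ P / √(1 - N) := by positivity
  have hb : P / √(1 - N) * √N - X / √(1 + Υ - N) * (N / √(N + δ)) ≤
      P / √(1 - N) * √N * (1 - √N / √(N + δ)) := by
    have h1 : P / √(1 - N) * (N / √(N + δ)) ≤ X / √(1 + Υ - N) * (N / √(N + δ)) :=
      mul_le_mul_of_nonneg_right hcmp (by positivity)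
    have h2 : P / √(1 - N) * √N * (√N / √(N + δ)) = P / √(1 - N) * (N / √(N + δ)) := by
      rw [mul_assoc, ← mul_div_assoc, ← hNs]
    linarith
  have hKY : K * Y ≤ 1 / 2 * (1 / η ^ 2) := mul_le_mul hK1 hY1 hY0 (by norm_num)
  have hr0 : 0 ≤ 1 - √N / √(N + δ) := by
    rw [sub_nonneg, div_le_one hs4]
    exact Real.sqrt_le_sqrt (by linarith)
  calc K * Y * (2 * N) * (P / √(1 - N) * √N - X / √(1 + Υ - N) * (N / √(N + δ)))
      ≤ K * Y * (2 * N) * (P / √(1 - N) * √N * (1 - √N / √(N + δ))) :=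
        mul_le_mul_of_nonneg_left hb (by positivity)
    _ = 2 * (K * Y) * (P / √(1 - N) * √N) * (N * (1 - √N / √(N + δ))) := by ring
    _ ≤ 2 * (1 / 2 * (1 / η ^ 2)) * (2 * 1) * δ := by
        refine mul_le_mul ?_ (mul_one_sub_div_sqrt_le hN0 hδ) (by positivity) (by positivity)
        refine mul_le_mul ?_ (mul_le_mul hPw hsN (Real.sqrt_nonneg _) (by norm_num)) (by positivity)
          (by positivity)
        linarith
    _ = 2 * δ / η ^ 2 := by ring

/-! ### The flux of the approximate calibration through Pansu's sphere -/

/-- Graphs are null sets, which reconciles the open Pansu set with the half-open regions of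
`setIntegral_divH_between`. -/
lemma ae_snd_ne {f : (Fin n → ℂ) → ℝ} (hf : Measurable f) :
    ∀ᵐ p : Heisenberg n, p.2 ≠ f p.1 := by
  rw [ae_iff]
  simp only [ne_eq, not_not]
  have hs : MeasurableSet {p : Heisenberg n | p.2 = f p.1} :=
    measurableSet_eq_fun measurable_snd (hf.comp measurable_fst)
  rw [Measure.volume_eq_prod, Measure.measure_prod_null hs]
  refine Filter.Eventually.of_forall fun z => ?_
  have : Prod.mk z ⁻¹' {p : Heisenberg n | p.2 = f p.1} = {f z} := by
    ext t; simp
  change volume (Prod.mk z ⁻¹' {p : Heisenberg n | p.2 = f p.1}) = 0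
  rw [this, Real.volume_singleton]

lemma divH_eq_zero {V : Heisenberg n → EuclideanSpace ℝ (Fin n ⊕ Fin n)} {p : Heisenberg n}
    (h : V =ᶠ[nhds p] fun _ => 0) : divH V p = 0 := by
  have hi : ∀ i, fderiv ℝ (fun q => V q i) p = 0 := by
    intro i
    have : (fun q => V q i) =ᶠ[nhds p] fun _ => (0 : ℝ) := by
      filter_upwards [h] with q hq
      rw [hq]; rfl
    rw [this.fderiv_eq]
    simp
  simp [divH, hi]

/-- The flux density of the approximate calibration through Pansu's sphere. -/
def fluxDensity (δ : ℝ) (z : Fin n → ℂ) : ℝ :=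
  4 * sqNorm z * Real.smoothTransition (sqProfile (sqNorm z) / δ - 1) *
    (√(1 - sqNorm z) / √(sqNorm z + δ) + √(sqNorm z) / √(1 - sqNorm z))

lemma graphFlux_calibration_top (hδ : 0 < δ) (hR : 2 ≤ R) {z : Fin n → ℂ}
    (hz : δ < sqProfile (sqNorm z)) :
    graphFlux (fun z => sqProfile (sqNorm z)) (calibration c η R δ) z = fluxDensity δ z / 2 := by
  have hN : sqNorm z < 1 := sqProfile_pos_iff.1 (hδ.trans hz)
  have hd : HasFDerivAt (fun z : Fin n → ℂ => sqProfile (sqNorm z))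
      ((1 * (-√(sqNorm z) / √(1 - sqNorm z))) • sqNormDeriv z) z :=
    hasFDerivAt_radial hN (hasDerivAt_id _)
  rw [calibration, graphFlux_radialField hd.fderiv]
  have hP : |sqProfile (sqNorm z)| ≤ R := by
    rw [abs_of_nonneg (sqProfile_nonneg _)]
    exact (sqProfile_le_two (sqNorm_nonneg _)).trans hR
  simp only [radialCoeff, angularCoeff, curvature_of_tilt_eq_zero (tilt_of_le le_rfl),
    cylinderCutoff_of_abs_le hP, smoothSign_of_le hδ hz.le, fluxDensity]
  ring_nf

/-- On the lower hemisphere t ≤ 0 ≤ c, so the tilt is switched off and a = 1. The angular part and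
the slope both change sign, so the outward flux equals that of the upper hemisphere. -/
lemma graphFlux_calibration_bottom (hc : 0 ≤ c) (hη : 0 < η) (hδ : 0 < δ) (hR : 2 ≤ R)
    {z : Fin n → ℂ} (hz : δ < sqProfile (sqNorm z)) :
    graphFlux (fun z => -sqProfile (sqNorm z)) (calibration c η R δ) z = -(fluxDensity δ z / 2) := by
  have hN : sqNorm z < 1 := sqProfile_pos_iff.1 (hδ.trans hz)
  have hd := hasFDerivAt_radial hN (hasDerivAt_neg _)
  rw [calibration, graphFlux_radialField hd.fderiv]
  have hP : |-sqProfile (sqNorm z)| ≤ R := by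
    rw [abs_neg, abs_of_nonneg (sqProfile_nonneg _)]
    exact (sqProfile_le_two (sqNorm_nonneg _)).trans hR
  have ht : tilt c η δ (sqProfile (sqNorm z)) (-sqProfile (sqNorm z)) = 0 :=
    tilt_of_sub_le hη (by linarith)
  simp only [radialCoeff, angularCoeff, curvature_of_tilt_eq_zero ht,
    cylinderCutoff_of_abs_le hP, smoothSign_neg, smoothSign_of_le hδ hz.le, fluxDensity]
  ring_nf

lemma graphFlux_calibration_eq_zero (hδ : 0 < δ) {z : Fin n → ℂ} (g : (Fin n → ℂ) → ℝ)
    (hz : sqProfile (sqNorm z) ≤ δ) : graphFlux g (calibration c η R δ) z = 0 := by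
  simp [graphFlux, calibration_eq_zero (p := (z, g z)) (cylinderCutoff_eq_zero hδ hz)]

lemma setIntegral_divH_calibration (hc : 0 ≤ c) (hη : 0 < η) (hδ : 0 < δ) (hR : 2 ≤ R) :
    ∫ p in pansuSet n, divH (calibration c η R δ) p = ∫ z : Fin n → ℂ, fluxDensity δ z := by
  -- Gauss–Green needs a C¹ graph, and the profile fails at the rim. It is altered only where its
  -- height is below δ, and there the calibration vanishes.
  set h : ℝ → ℝ := fun x => x * Real.smoothTransition (2 * x / δ - 1)
  have hh : ContDiff ℝ 1 h :=
    contDiff_id.mul (Real.smoothTransition.contDiff.comp (by fun_prop))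
  have h0 : ∀ x ≤ δ / 2, h x = 0 := fun x hx => by
    have : 2 * x / δ ≤ 1 := (div_le_one hδ).2 (by linarith)
    simp only [h]
    rw [Real.smoothTransition.zero_of_nonpos (by linarith), mul_zero]
  have h1 : ∀ x, δ ≤ x → h x = x := fun x hx => by
    have : 2 ≤ 2 * x / δ := (le_div_iff₀ hδ).2 (by linarith)
    simp only [h]
    rw [Real.smoothTransition.one_of_one_le (by linarith), mul_one]
  set g : (Fin n → ℂ) → ℝ := fun z => h (sqProfile (sqNorm z))
  have hg : ContDiff ℝ 1 g := contDiff_radial hh (half_pos hδ) h0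
  have hg0 : ∀ z, 0 ≤ g z := fun z =>
    mul_nonneg (sqProfile_nonneg _) (Real.smoothTransition.nonneg _)
  have hV := contDiff_calibration (n := n) (c := c) (R := R) hη hδ
  have hVc := hasCompactSupport_calibration (n := n) (c := c) (η := η) (by linarith : 0 ≤ R) hδ
  have hset : ∫ p in pansuSet n, divH (calibration c η R δ) p =
      ∫ p in {p : Heisenberg n | -g p.1 ≤ p.2 ∧ p.2 < g p.1}, divH (calibration c η R δ) p := by
    have hgm : Measurable fun p : Heisenberg n => g p.1 :=
      hg.continuous.measurable.comp measurable_fst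
    have hSm : MeasurableSet {p : Heisenberg n | -g p.1 ≤ p.2 ∧ p.2 < g p.1} :=
      (measurableSet_le hgm.neg measurable_snd).inter (measurableSet_lt measurable_snd hgm)
    rw [← integral_indicator isOpen_pansuSet.measurableSet, ← integral_indicator hSm]
    refine integral_congr_ae ?_
    filter_upwards [ae_snd_ne (f := fun z : Fin n → ℂ => -sqProfile (sqNorm z))
      (continuous_sqProfile.comp continuous_sqNorm).measurable.neg] with p hp
    rcases lt_or_ge (sqProfile (sqNorm p.1)) δ with hP | hP
    · have hz : divH (calibration c η R δ) p = 0 := by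
        refine divH_eq_zero ?_
        filter_upwards [continuous_height.continuousAt.eventually_lt_const hP] with q hq
        exact calibration_eq_zero (cylinderCutoff_eq_zero hδ hq.le)
      exact (Set.indicator_apply_eq_zero.2 fun _ => hz).trans
        (Set.indicator_apply_eq_zero.2 fun _ => hz).symm
    · have hgp : g p.1 = sqProfile (sqNorm p.1) := h1 _ hP
      have hiff : p ∈ pansuSet n ↔
          p ∈ {p : Heisenberg n | -g p.1 ≤ p.2 ∧ p.2 < g p.1} := by
        rw [Set.mem_ofPred_eq, mem_pansuSet_iff, hgp, abs_lt]
        exact and_congr_left fun _ => ⟨le_of_lt, fun h => lt_of_le_of_ne h (Ne.symm hp)⟩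
      by_cases hm : p ∈ pansuSet n
      · rw [Set.indicator_of_mem hm]
        exact (Set.indicator_of_mem (hiff.1 hm) _).symm
      · rw [Set.indicator_of_notMem hm]
        exact (Set.indicator_of_notMem (fun h => hm (hiff.2 h)) _).symm
  rw [hset, setIntegral_divH_between hg hg0 hV hVc]
  refine integral_congr_ae (Filter.Eventually.of_forall fun z => ?_)
  change graphFlux g _ z - graphFlux (fun z => -g z) _ z = _
  rcases le_or_gt (sqProfile (sqNorm z)) δ with hz | hz
  · rw [graphFlux_calibration_eq_zero hδ _ hz, graphFlux_calibration_eq_zero hδ _ hz, fluxDensity]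
    have : sqProfile (sqNorm z) / δ ≤ 1 := (div_le_one hδ).2 hz
    rw [Real.smoothTransition.zero_of_nonpos (by linarith)]
    ring
  · have he : g =ᶠ[nhds z] fun z => sqProfile (sqNorm z) := by
      filter_upwards [(continuous_sqProfile.comp
        continuous_sqNorm).continuousAt.eventually_const_lt hz] with y hy
      exact h1 _ (le_of_lt hy)
    have he' : (fun z => -g z) =ᶠ[nhds z] fun z => -sqProfile (sqNorm z) := by
      filter_upwards [he] with y hy
      rw [hy]
    rw [graphFlux_congr he, graphFlux_congr he', graphFlux_calibration_top hδ hR hz,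
      graphFlux_calibration_bottom hc hη hδ hR hz]
    ring

lemma fluxDensity_nonneg (δ : ℝ) (z : Fin n → ℂ) : 0 ≤ fluxDensity δ z := by
  have := Real.smoothTransition.nonneg (sqProfile (sqNorm z) / δ - 1)
  have := sqNorm_nonneg z
  unfold fluxDensity
  positivity

lemma two_mul_areaDensity {z : Fin n → ℂ} (hz : sqNorm z < 1) :
    2 * areaDensity z = 4 * (√(sqNorm z) * √(1 - sqNorm z) +
      sqNorm z * (√(sqNorm z) / √(1 - sqNorm z))) := by
  have hw : 0 < 1 - sqNorm z := by linarith
  have hs := Real.sqrt_pos.2 hw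
  rw [areaDensity]
  have e : √(1 - sqNorm z) ^ 2 = 1 - sqNorm z := Real.sq_sqrt hw.le
  field_simp
  rw [e]
  ring

lemma fluxDensity_le (hδ : 0 < δ) (z : Fin n → ℂ) : fluxDensity δ z ≤ 2 * areaDensity z := by
  rcases lt_or_ge (sqNorm z) 1 with hz | hz
  · rw [two_mul_areaDensity hz, fluxDensity]
    have hN := sqNorm_nonneg z
    have hs0 := Real.smoothTransition.nonneg (sqProfile (sqNorm z) / δ - 1)
    have hs1 := Real.smoothTransition.le_one (sqProfile (sqNorm z) / δ - 1)
    have h1 : sqNorm z * (√(1 - sqNorm z) / √(sqNorm z + δ)) ≤ √(sqNorm z) * √(1 - sqNorm z) := by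
      rw [← mul_div_assoc, div_le_iff₀ (Real.sqrt_pos.2 (by linarith))]
      have h2 : √(sqNorm z) ≤ √(sqNorm z + δ) := Real.sqrt_le_sqrt (by linarith)
      calc sqNorm z * √(1 - sqNorm z) = √(sqNorm z) * √(1 - sqNorm z) * √(sqNorm z) := by
            rw [mul_right_comm, Real.mul_self_sqrt hN]
        _ ≤ _ := mul_le_mul_of_nonneg_left h2 (by positivity)
    have h0 : 0 ≤ 4 * (sqNorm z * (√(1 - sqNorm z) / √(sqNorm z + δ)) +
      sqNorm z * (√(sqNorm z) / √(1 - sqNorm z))) := by positivity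
    calc 4 * sqNorm z * Real.smoothTransition (sqProfile (sqNorm z) / δ - 1) *
          (√(1 - sqNorm z) / √(sqNorm z + δ) + √(sqNorm z) / √(1 - sqNorm z))
        = Real.smoothTransition (sqProfile (sqNorm z) / δ - 1) *
          (4 * (sqNorm z * (√(1 - sqNorm z) / √(sqNorm z + δ)) +
            sqNorm z * (√(sqNorm z) / √(1 - sqNorm z)))) := by ring
      _ ≤ 1 * (4 * (sqNorm z * (√(1 - sqNorm z) / √(sqNorm z + δ)) +
            sqNorm z * (√(sqNorm z) / √(1 - sqNorm z)))) := mul_le_mul_of_nonneg_right hs1 h0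
      _ ≤ _ := by linarith
  · rw [areaDensity_of_one_le hz, fluxDensity, sqProfile_of_one_le hz,
      Real.smoothTransition.zero_of_nonpos (by simp)]
    simp

lemma measurable_fluxDensity (δ : ℝ) : Measurable (fluxDensity δ : (Fin n → ℂ) → ℝ) := by
  have h1 := (continuous_sqNorm (n := n)).measurable
  have h2 : Measurable sqProfile := continuous_sqProfile.measurable
  have h3 : Measurable Real.smoothTransition := Real.smoothTransition.continuous.measurable
  unfold fluxDensity
  fun_prop

/-- Asymptotic sharpness of the calibration: the limit is the upper bound of
`perimeter_pansuSet_le`. Twice the area density dominates. -/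
lemma tendsto_integral_fluxDensity (hn : 1 ≤ n) {δ : ℕ → ℝ} (hδ : ∀ k, 0 < δ k)
    (hδ0 : Filter.Tendsto δ Filter.atTop (nhds 0)) :
    Filter.Tendsto (fun k => ∫ z : Fin n → ℂ, fluxDensity (δ k) z) Filter.atTop
      (nhds (2 * ∫ z : Fin n → ℂ, areaDensity z)) := by
  rw [← integral_const_mul]
  refine tendsto_integral_of_dominated_convergence (fun z => 2 * areaDensity z)
    (fun k => (measurable_fluxDensity (δ k)).aestronglyMeasurable)
    ((integrable_areaDensity hn).const_mul 2)
    (fun k => Filter.Eventually.of_forall fun z => ?_) (Filter.Eventually.of_forall fun z => ?_)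
  · rw [Real.norm_of_nonneg (fluxDensity_nonneg _ _)]
    exact fluxDensity_le (hδ k) z
  · rcases lt_or_ge (sqNorm z) 1 with hz | hz
    · have hP : 0 < sqProfile (sqNorm z) := sqProfile_pos_iff.2 hz
      have hev : ∀ᶠ k in Filter.atTop, 4 * (sqNorm z * (√(1 - sqNorm z) / √(sqNorm z + δ k)) +
          sqNorm z * (√(sqNorm z) / √(1 - sqNorm z))) = fluxDensity (δ k) z := by
        filter_upwards [hδ0.eventually_lt_const (half_pos hP)] with k hk
        have : 2 ≤ sqProfile (sqNorm z) / δ k := (le_div_iff₀ (hδ k)).2 (by linarith)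
        rw [fluxDensity, Real.smoothTransition.one_of_one_le (by linarith)]
        ring
      refine Filter.Tendsto.congr' hev ?_
      rw [two_mul_areaDensity hz]
      refine Filter.Tendsto.const_mul _ (Filter.Tendsto.add_const _ ?_)
      rcases (sqNorm_nonneg z).eq_or_lt with h0 | h0
      · simp [← h0]
      · have hs := Real.sqrt_pos.2 h0
        have e : √(sqNorm z) * √(1 - sqNorm z) =
            sqNorm z * (√(1 - sqNorm z) / √(sqNorm z + 0)) := by
          rw [add_zero]
          nth_rw 3 [← Real.mul_self_sqrt h0.le]
          field_simp
        rw [e]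
        refine Filter.Tendsto.const_mul _ (Filter.Tendsto.div tendsto_const_nhds ?_
          (by rw [add_zero]; exact hs.ne'))
        exact (Real.continuous_sqrt.tendsto _).comp (hδ0.const_add _)
    · rw [areaDensity_of_one_le hz]
      refine tendsto_const_nhds.congr fun k => ?_
      have h1 := fluxDensity_nonneg (δ k) z
      have h2 := fluxDensity_le (hδ k) z
      rw [areaDensity_of_one_le hz] at h2
      linarith

/-! ### The gap between the perimeters -/

lemma le_one_sub_one_div_sqrt {y U : ℝ} (hy : y < 1) (hU : 0 ≤ U)
    (h : 1 ≤ (1 - y) ^ 2 * (1 + U)) : y ≤ 1 - 1 / √(1 + U) := by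
  have hs : 0 < √(1 + U) := Real.sqrt_pos.2 (by linarith)
  have h1 : 1 ≤ (1 - y) * √(1 + U) := by
    refine (one_le_sq_iff₀ (mul_nonneg (by linarith) hs.le)).1 ?_
    rw [mul_pow, Real.sq_sqrt (by linarith)]
    exact h
  have : 1 / √(1 + U) ≤ 1 - y := (div_le_iff₀ hs).2 h1
  linarith

/-- Write U = (X - P)(X + P) / 4 with X - P = (P - t)(P - t + 2c) / (2 (t - c)). The remaining
factor (X + P) / (2 (t - c)) is at least 1 because X ≥ P ≥ t - c. -/
lemma le_leafParam {P t : ℝ} (hc : 0 ≤ c) (ht : c < t) (htP : t < P) :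
    (P - t) * (P - t + 2 * c) / 4 ≤ leafParam c P t := by
  have hT : 0 < t - c := by linarith
  have e : leafParam c P t = (P - t) * (P - t + 2 * c) / 4 *
      ((((P ^ 2 - c ^ 2) / (t - c) + (t - c)) / 2 + P) / (2 * (t - c))) := by
    unfold leafParam
    field_simp
    ring
  rw [e]
  refine le_mul_of_one_le_right ?_ ((one_le_div (by linarith)).2 ?_)
  · have : 0 ≤ (P - t) * (P - t + 2 * c) := mul_nonneg (by linarith) (by linarith)
    linarith
  · have hX : P ≤ ((P ^ 2 - c ^ 2) / (t - c) + (t - c)) / 2 := by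
      have : ((P ^ 2 - c ^ 2) / (t - c) + (t - c)) / 2 - P =
          ((P - t) * (P - t + 2 * c)) / (2 * (t - c)) := by
        field_simp; ring
      have h2 : 0 ≤ ((P - t) * (P - t + 2 * c)) / (2 * (t - c)) :=
        div_nonneg (mul_nonneg (by linarith) (by linarith)) (by linarith)
      linarith
    linarith

lemma quadratic_gap {P t : ℝ} (hc : 0 ≤ c) (ht : c < t) (htP : t < P) (hP : P ≤ 2) :
    1 / 20 * (P - t) ^ 2 ≤ 1 - 1 / √(1 + leafParam c P t) := by
  have h := le_leafParam hc ht htP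
  set s := P - t
  have hs0 : 0 < s := by simp only [s]; linarith
  have hs2 : s ≤ 2 := by simp only [s]; linarith
  have hU : s ^ 2 / 4 ≤ leafParam c P t := by nlinarith [mul_nonneg hs0.le hc]
  have hU0 : 0 ≤ leafParam c P t := le_trans (by positivity) hU
  have hs4 : s ^ 2 ≤ 4 := by nlinarith
  refine le_one_sub_one_div_sqrt (by linarith) hU0 ?_
  have h1 : (1 - 1 / 20 * s ^ 2) ^ 2 * (1 + s ^ 2 / 4) ≤
      (1 - 1 / 20 * s ^ 2) ^ 2 * (1 + leafParam c P t) :=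
    mul_le_mul_of_nonneg_left (by linarith) (sq_nonneg _)
  refine le_trans ?_ h1
  set y := s ^ 2
  have hy : 0 ≤ y := sq_nonneg s
  -- As P ≤ 2, the depth is at most 2 and y ≤ 4; the bracket is positive on [0, 4].
  have : (1 - 1 / 20 * y) ^ 2 * (1 + y / 4) - 1 = y * (3 / 20 - 9 / 400 * y + y ^ 2 / 1600) := by
    ring
  have h3 : 0 ≤ y * (3 / 20 - 9 / 400 * y + y ^ 2 / 1600) :=
    mul_nonneg hy (by nlinarith [sq_nonneg y])
  linarith

lemma linear_gap {P t e : ℝ} (hec : 2 * e ^ 2 ≤ c ^ 2) (hc : 0 ≤ c) (ht : c < t)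
    (htP : t < P) (hP : P ≤ 2) :
    e / 4 * (P - t) ^ 1 ≤ 1 - 1 / √(1 + leafParam c P t) := by
  have h := le_leafParam hc ht htP
  have hcs : c + (P - t) ≤ 2 := by linarith
  rw [pow_one]
  set s := P - t
  have hs0 : 0 < s := by simp only [s]; linarith
  have hx0 : 0 ≤ c * s := by positivity
  have hx1 : c * s ≤ 1 := by nlinarith [sq_nonneg (c - s)]
  -- 0.708 rounds 1/√2 up, and 0.177 = 0.708 / 4. In the polynomial below, with x = c s ≤ 1,
  -- positivity comes down to 0.146 > 0.145671.
  have hec' : e ≤ 0.708 * c := by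
    refine le_of_sq_le_sq ?_ (by positivity)
    nlinarith [sq_nonneg c]
  have hy : e / 4 * s ≤ 0.177 * (c * s) := by nlinarith
  have hU : c * s / 2 ≤ leafParam c P t := by nlinarith
  refine le_one_sub_one_div_sqrt (by linarith) (by linarith) ?_
  set x := c * s
  have h1 : (1 - 0.177 * x) ^ 2 * (1 + x / 2) ≤ (1 - e / 4 * s) ^ 2 * (1 + leafParam c P t) := by
    refine mul_le_mul (pow_le_pow_left₀ (by linarith) (by linarith) 2) (by linarith) (by linarith)
      (sq_nonneg _)
  refine le_trans ?_ h1
  have : (1 - 0.177 * x) ^ 2 * (1 + x / 2) - 1 =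
      x * (0.146 - 0.145671 * x + 0.0156645 * x ^ 2) := by
    ring
  have h3 : 0 ≤ x * (0.146 - 0.145671 * x + 0.0156645 * x ^ 2) :=
    mul_nonneg hx0 (by nlinarith [sq_nonneg x])
  linarith

/-! ### A bathtub inequality -/

lemma volume_sqNorm_lt_one (hn : 1 ≤ n) :
    volume {z : Fin n → ℂ | sqNorm z < 1} = ENNReal.ofReal (unitBallVolume (2 * n)) := by
  have : Nonempty (Fin (2 * n)) := ⟨⟨0, by omega⟩⟩
  rw [unitBallVolume, ENNReal.ofReal_toReal measure_ball_lt_top.ne, EuclideanSpace.volume_ball]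
  have h := Complex.volume_sum_rpow_lt_one (Fin n) (p := 2) (by norm_num)
  have hset : {z : Fin n → ℂ | sqNorm z < 1} = {z : Fin n → ℂ | ∑ i, ‖z i‖ ^ (2 : ℝ) < 1} := by
    ext z; simp [sqNorm]
  rw [hset, h]
  simp only [ENNReal.ofReal_one, one_pow, one_mul, Fintype.card_fin]
  congr 2
  · rw [pow_mul, Real.sq_sqrt Real.pi_pos.le]
    norm_num [Real.Gamma_two]
  · push_cast
    ring_nf

lemma unitBallVolume_pos (k : ℕ) : 0 < unitBallVolume k :=
  ENNReal.toReal_pos (Metric.measure_ball_pos volume _ one_pos).ne' measure_ball_lt_top.ne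

lemma integral_sub_pow {s : ℝ} (hs : 0 ≤ s) (d : ℕ) :
    ∫ t in Set.Ico (-s) 0, (s ^ d - (-t) ^ d) = s ^ (d + 1) - s ^ (d + 1) / (d + 1) := by
  rw [integral_Ico_eq_integral_Ioc, ← intervalIntegral.integral_of_le (by linarith)]
  rw [intervalIntegral.integral_comp_neg fun t => s ^ d - t ^ d,
    intervalIntegral.integral_sub (by simp) (by simp), integral_pow]
  simp
  ring

/-- The vertical shear turns the layer below the hemisphere into ball × [-s, 0), where the integrand
depends on the height alone. -/
lemma setIntegral_layer (hn : 1 ≤ n) {s : ℝ} (hs : 0 ≤ s) (d : ℕ) :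
    ∫ p in {p : Heisenberg n | sqNorm p.1 < 1 ∧ sqProfile (sqNorm p.1) - s ≤ p.2 ∧
        p.2 < sqProfile (sqNorm p.1)}, (s ^ d - (sqProfile (sqNorm p.1) - p.2) ^ d) =
      unitBallVolume (2 * n) * (s ^ (d + 1) - s ^ (d + 1) / (d + 1)) := by
  have hP : Continuous fun z : Fin n → ℂ => sqProfile (sqNorm z) :=
    continuous_sqProfile.comp continuous_sqNorm
  rw [← (measurePreserving_shear hP).setIntegral_preimage_emb (shear hP).measurableEmbedding]
  have hset : (shear hP) ⁻¹' {p : Heisenberg n | sqNorm p.1 < 1 ∧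
      sqProfile (sqNorm p.1) - s ≤ p.2 ∧ p.2 < sqProfile (sqNorm p.1)} =
      {z : Fin n → ℂ | sqNorm z < 1} ×ˢ Set.Ico (-s) 0 := by
    ext p
    simp only [shear, Set.mem_preimage, Set.mem_prod, Set.mem_ofPred_eq, Set.mem_Ico]
    refine and_congr_right fun _ => and_congr ?_ ?_
    · constructor <;> intro h <;> change _ ≤ _ at h ⊢ <;> simp at h ⊢ <;> linarith
    · constructor <;> intro h <;> change _ < _ at h ⊢ <;> simp at h ⊢ <;> linarith
  rw [hset]
  have hf : ∀ p : Heisenberg n, s ^ d - (sqProfile (sqNorm (shear hP p).1) - (shear hP p).2) ^ d =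
      (1 : ℝ) * (s ^ d - (-p.2) ^ d) := by
    intro p
    change s ^ d - (sqProfile (sqNorm p.1) - (p.2 + sqProfile (sqNorm p.1))) ^ d = _
    ring_nf
  simp only [hf]
  rw [Measure.volume_eq_prod,
    setIntegral_prod_mul (fun _ : Fin n → ℂ => (1 : ℝ)) (fun t : ℝ => s ^ d - (-t) ^ d),
    integral_sub_pow hs]
  congr 1
  rw [setIntegral_const, smul_eq_mul, mul_one, measureReal_def, volume_sqNorm_lt_one hn,
    ENNReal.toReal_ofReal (unitBallVolume_pos _).le]

lemma continuous_depth_pow (d : ℕ) :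
    Continuous fun p : Heisenberg n => (sqProfile (sqNorm p.1) - p.2) ^ d :=
  (continuous_height.sub continuous_snd).pow d

lemma integrableOn_of_subset_pansuSet {f : Heisenberg n → ℝ} (hf : Continuous f)
    {A : Set (Heisenberg n)} (hA : A ⊆ pansuSet n) : IntegrableOn f A :=
  (hf.continuousOn.integrableOn_compact (isCompact_closedBall 0 2)).mono_set
    (hA.trans pansuSet_subset)

/-- Among subsets of given volume of the region below the upper hemisphere, the layer adjacent to
the hemisphere has the least integral of a power of the depth. -/
lemma bathtub (hn : 1 ≤ n) (d : ℕ) {A : Set (Heisenberg n)} (hA : NullMeasurableSet A)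
    (hAE : A ⊆ pansuSet n) :
    volume.real A ^ (d + 1) / ((d + 1) * unitBallVolume (2 * n) ^ d) ≤
      ∫ p in A, (sqProfile (sqNorm p.1) - p.2) ^ d := by
  set ω := unitBallVolume (2 * n)
  have hω : 0 < ω := unitBallVolume_pos _
  set m := volume.real A
  have hm : 0 ≤ m := measureReal_nonneg
  -- The thickness for which the layer B has the volume m of A.
  set s := m / ω
  have hs : 0 ≤ s := by positivity
  set D : Heisenberg n → ℝ := fun p => sqProfile (sqNorm p.1) - p.2
  have hD : Continuous D := continuous_height.sub continuous_snd
  set B : Set (Heisenberg n) := {p | sqNorm p.1 < 1 ∧ sqProfile (sqNorm p.1) - s ≤ p.2 ∧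
    p.2 < sqProfile (sqNorm p.1)}
  have hP := continuous_height (n := n)
  have hB : MeasurableSet B :=
    (measurableSet_lt (continuous_sqNorm.comp continuous_fst).measurable measurable_const).inter
      ((measurableSet_le (hP.measurable.sub_const s) measurable_snd).inter
        (measurableSet_lt measurable_snd hP.measurable))
  have hBball : B ⊆ Metric.closedBall 0 (2 + s) := by
    intro p hp
    have h2 := sqProfile_le_two (sqNorm_nonneg p.1)
    have h0 := sqProfile_nonneg (sqNorm p.1)
    rw [mem_closedBall_zero_iff, Prod.norm_def, max_le_iff]
    refine ⟨norm_le_of_sqNorm_le (by linarith) (by nlinarith [hp.1]), ?_⟩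
    rw [Real.norm_eq_abs, abs_le]
    constructor <;> linarith [hp.2.1, hp.2.2]
  have hg : Continuous fun p => s ^ d - D p ^ d := by fun_prop
  have hgB : IntegrableOn (fun p => s ^ d - D p ^ d) B :=
    (hg.continuousOn.integrableOn_compact (isCompact_closedBall 0 (2 + s))).mono_set hBball
  have hgi : Integrable (B.indicator fun p => s ^ d - D p ^ d) :=
    (integrable_indicator_iff hB).2 hgB
  have hAfin : volume A ≠ ⊤ := measure_ne_top_of_subset hAE volume_pansuSet_ne_top
  have hg0 : ∀ p, 0 ≤ B.indicator (fun p => s ^ d - D p ^ d) p := by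
    refine Set.indicator_nonneg fun p hp => ?_
    rw [sub_nonneg]
    exact pow_le_pow_left₀ (by simp only [D]; linarith [hp.2.2]) (by simp only [D]; linarith [hp.2.1]) d
  -- On A the left side is min (s^d, D^d). Near the rim B may stick out of Pansu's set; this is
  -- harmless, since the subtracted integral is only enlarged to all of B.
  have hpt : ∀ p ∈ A, s ^ d - B.indicator (fun p => s ^ d - D p ^ d) p ≤ D p ^ d := by
    intro p hp
    have hE := mem_pansuSet_iff.1 (hAE hp)
    have hlt := (abs_lt.1 hE).2
    by_cases hpB : p ∈ B
    · rw [Set.indicator_of_mem hpB]; linarith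
    · rw [Set.indicator_of_notMem hpB, sub_zero]
      refine pow_le_pow_left₀ hs ?_ d
      by_contra hcon
      refine hpB ⟨sqProfile_pos_iff.1 ((abs_nonneg _).trans_lt hE), ?_, hlt⟩
      have : D p < s := not_le.1 hcon
      simp only [D] at this
      linarith
  have h1 : ∫ p in A, (s ^ d - B.indicator (fun p => s ^ d - D p ^ d) p) ≤ ∫ p in A, D p ^ d := by
    refine integral_mono_ae ((integrableOn_const hAfin).sub hgi.integrableOn)
      (integrableOn_of_subset_pansuSet (hD.pow d) hAE) ?_
    exact (ae_restrict_iff'₀ hA).2 (Filter.Eventually.of_forall hpt)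
  have h2 : ∫ p in A, B.indicator (fun p => s ^ d - D p ^ d) p ≤
      ω * (s ^ (d + 1) - s ^ (d + 1) / (d + 1)) := by
    rw [← setIntegral_layer hn hs d, ← integral_indicator hB]
    exact setIntegral_le_integral hgi (Filter.Eventually.of_forall hg0)
  rw [integral_sub (f := fun _ => s ^ d) (integrableOn_const hAfin) hgi.integrableOn, setIntegral_const,
    smul_eq_mul] at h1
  have hms : m = ω * s := by simp only [s]; field_simp
  have e : m ^ (d + 1) / ((d + 1) * ω ^ d) =
      m * s ^ d - ω * (s ^ (d + 1) - s ^ (d + 1) / (d + 1)) := by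
    rw [hms]
    field_simp
    ring
  rw [e]
  linarith

/-! ### The lower bound for the perimeter of a competitor -/

/-- Lower bound for the perimeter of a competitor, in terms of a lower bound `f` for the curvature
defect of the leaves. -/
lemma le_perimeter_of_gap (hn : 1 ≤ n) {F : Set (Heisenberg n)} (hF : NullMeasurableSet F)
    (hvol : volume F = volume (pansuSet n)) {ε : ℝ} (hc : 0 ≤ profile (1 - ε))
    (hcomp : CompactlyContained (symmDiff F (pansuSet n)) (halfCylinder n ε))
    {f : Heisenberg n → ℝ} (hf : Continuous f)
    (hgap : ∀ p : Heisenberg n, profile (1 - ε) < p.2 → p.2 < sqProfile (sqNorm p.1) →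
      f p ≤ 1 - 1 / √(1 + leafParam (profile (1 - ε)) (sqProfile (sqNorm p.1)) p.2)) :
    ENNReal.ofReal (2 * (∫ z : Fin n → ℂ, areaDensity z) + 2 * n * ∫ p in pansuSet n \ F, f p) ≤
      perimeter F := by
  set c := profile (1 - ε)
  set E := pansuSet n
  set K := closure (symmDiff F E)
  have hK : IsCompact K := hcomp.1
  have hKN : ∀ p ∈ K, sqNorm p.1 < 1 := fun p hp => by
    have := (hcomp.2 hp).1
    rwa [radius_eq, Real.sqrt_lt' one_pos, one_pow] at this
  have hE : MeasurableSet E := isOpen_pansuSet.measurableSet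
  have hdiff1 : E \ F ⊆ K := fun p hp => subset_closure (Or.inr hp)
  have hdiff2 : F \ E ⊆ K := fun p hp => subset_closure (Or.inl hp)
  -- This form of the minimum principle also covers empty K, that is F = E.
  obtain ⟨p0, hp0, hKp⟩ := hK.exists_forall_le' continuous_height.continuousOn
    (fun p hp => sqProfile_pos_iff.2 (hKN p hp))
  -- Halving leaves strict room η < t - c on K; as c ≥ 0, any δ < η is then also below t.
  obtain ⟨η, hη, hKη⟩ := hK.exists_forall_le' (f := fun p : Heisenberg n => (p.2 - c) / 2)
    (by fun_prop) (a := 0) (fun p hp => by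
      have : c < p.2 := (hcomp.2 hp).2
      linarith)
  obtain ⟨R, hR, hKR⟩ : ∃ R : ℝ, 2 ≤ R ∧ ∀ p ∈ K, |p.2| < R := by
    obtain ⟨R, hR⟩ := hK.exists_bound_of_continuousOn (f := fun p : Heisenberg n => p.2)
      continuous_snd.continuousOn
    exact ⟨max 2 (R + 1), le_max_left _ _, fun p hp =>
      lt_max_of_lt_right ((hR p hp).trans_lt (lt_add_one R))⟩
  have hEfin : volume E ≠ ⊤ := volume_pansuSet_ne_top
  have hFfin : volume F ≠ ⊤ := hvol ▸ hEfin
  set m := volume.real (E \ F)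
  have hm : volume.real (F \ E) = m := by
    have h1 := measure_inter_add_sdiff₀ (μ := volume) F hE.nullMeasurableSet
    have h2 := measure_inter_add_sdiff₀ (μ := volume) E hF
    rw [hvol, ← h2, Set.inter_comm E F] at h1
    have hfin : volume (F ∩ E) ≠ ⊤ := measure_ne_top_of_subset Set.inter_subset_left hFfin
    exact congrArg ENNReal.toReal ((ENNReal.add_right_inj hfin).1 h1)
  have hEF : NullMeasurableSet (E \ F) := hE.nullMeasurableSet.diff hF
  have hFE : NullMeasurableSet (F \ E) := hF.diff hE.nullMeasurableSet
  have hEFfin : volume (E \ F) ≠ ⊤ := measure_ne_top_of_subset Set.sdiff_subset hEfin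
  have hfi : IntegrableOn f (E \ F) := integrableOn_of_subset_pansuSet hf Set.sdiff_subset
  have huncut : ∀ δ, 0 < δ → δ < p0 / 2 → δ < η → ∀ p ∈ K, IsUncut c η R δ p := by
    intro δ _ h1 h2 p hp
    have h3 := hKp p hp
    have h4 := hKη p hp
    exact ⟨by linarith, hKR p hp, by linarith, by linarith⟩
  -- Compares the integrals over F and E through F \ E and E \ F. In the error, 2nδ comes from
  -- thresholding the leaf parameter and 2δ / η² from `IsUncut.divH_inside`.
  have hbound : ∀ δ, 0 < δ → δ < p0 / 2 → δ < η →
      (∫ z : Fin n → ℂ, fluxDensity δ z) + 2 * n * (∫ p in E \ F, f p) -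
        (2 * n + 2 / η ^ 2) * m * δ ≤ ∫ p in F, divH (calibration c η R δ) p := by
    intro δ hδ hδ1 hδ2
    have hu := huncut δ hδ hδ1 hδ2
    have hint := integrable_divH (contDiff_calibration (n := n) (c := c) (R := R) hη hδ)
      (hasCompactSupport_calibration (by linarith) hδ)
    rw [← setIntegral_divH_calibration hc hη hδ hR]
    have h1 := integral_inter_add_sdiff₀ (s := F) hE.nullMeasurableSet hint.integrableOn
    have h2 := integral_inter_add_sdiff₀ (s := E) hF hint.integrableOn
    rw [Set.inter_comm E F] at h2
    have h3 : ∫ p in F \ E, divH (calibration c η R δ) p = 2 * n * m := by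
      have : ∫ p in F \ E, divH (calibration c η R δ) p = ∫ _p in F \ E, (2 * n : ℝ) := by
        refine integral_congr_ae ((ae_restrict_iff'₀ hFE).2 (Filter.Eventually.of_forall
          fun p hp => (hu p (hdiff2 hp)).divH_outside hη hδ ?_))
        have hpE : ¬ |p.2| < sqProfile (sqNorm p.1) := fun h => hp.2 (mem_pansuSet_iff.2 h)
        have hpos : 0 < p.2 := hδ.trans (hu p (hdiff2 hp)).sign
        rw [abs_of_pos hpos] at hpE
        exact not_lt.1 hpE
      rw [this, setIntegral_const, smul_eq_mul, hm, mul_comm]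
    have hconst : IntegrableOn (fun _ : Heisenberg n => 2 * n + (2 * n + 2 / η ^ 2) * δ) (E \ F) :=
      integrableOn_const hEFfin
    have h4 : ∫ p in E \ F, divH (calibration c η R δ) p ≤
        ∫ p in E \ F, ((2 * n + (2 * n + 2 / η ^ 2) * δ) - 2 * n * f p) := by
      refine integral_mono_ae hint.integrableOn (hconst.sub (hfi.const_mul _))
        ((ae_restrict_iff'₀ hEF).2 (Filter.Eventually.of_forall fun p hp => ?_))
      have hin : p.2 < sqProfile (sqNorm p.1) := (abs_lt.1 (mem_pansuSet_iff.1 hp.1)).2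
      have hup := hu p (hdiff1 hp)
      have hηp := hKη p (hdiff1 hp)
      have hd := hup.divH_inside hη hδ hc hin (by linarith)
      rw [(hup.eventually_coeff hδ).self_of_nhds.1, curvature_eq hη hin hup.leaf] at hd
      have hg := hgap p (by linarith) hin
      have hcmp : 1 / √(1 + softThreshold δ (leafParam c (sqProfile (sqNorm p.1)) p.2)) ≤
          1 / √(1 + leafParam c (sqProfile (sqNorm p.1)) p.2) + δ := by
        have hU : 0 ≤ leafParam c (sqProfile (sqNorm p.1)) p.2 :=
          le_trans (div_nonneg (mul_nonneg (by linarith) (by linarith)) (by norm_num))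
            (le_leafParam hc (by linarith) hin)
        have hκ := le_softThreshold (δ := δ) (leafParam c (sqProfile (sqNorm p.1)) p.2)
        have hκ0 := softThreshold_nonneg δ (leafParam c (sqProfile (sqNorm p.1)) p.2)
        generalize leafParam c (sqProfile (sqNorm p.1)) p.2 = U at *
        generalize softThreshold δ U = Υ at *
        have ha : 1 ≤ √(1 + Υ) := Real.one_le_sqrt.2 (by linarith)
        have hb : 1 ≤ √(1 + U) := Real.one_le_sqrt.2 (by linarith)
        have ha2 : √(1 + Υ) ^ 2 = 1 + Υ := Real.sq_sqrt (by linarith)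
        have hb2 : √(1 + U) ^ 2 = 1 + U := Real.sq_sqrt (by linarith)
        generalize √(1 + Υ) = a at *
        generalize √(1 + U) = b at *
        -- Here b² - a² = U - Υ ≤ 2δ, while a + b ≥ 2.
        have hba : b - a ≤ δ := by nlinarith
        have : 1 / a - 1 / b = (b - a) / (a * b) := by field_simp
        have h5 : (b - a) / (a * b) ≤ δ := by
          rw [div_le_iff₀ (by positivity)]
          have : 1 ≤ a * b := by nlinarith
          nlinarith
        linarith
      have hn0 : (0 : ℝ) ≤ 2 * n := by positivity
      have h6 := mul_le_mul_of_nonneg_left hcmp hn0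
      have h7 := mul_le_mul_of_nonneg_left hg hn0
      have e : 2 * δ / η ^ 2 = 2 / η ^ 2 * δ := by ring
      change divH (calibration c η R δ) p ≤ (2 * n + (2 * n + 2 / η ^ 2) * δ) - 2 * n * f p
      linarith
    rw [integral_sub hconst (hfi.const_mul _), setIntegral_const,
      smul_eq_mul, integral_const_mul] at h4
    change _ ≤ m * _ - _ at h4
    linarith
  set δ : ℕ → ℝ := fun k => 1 / (k + 1 : ℝ)
  have hδ : ∀ k, 0 < δ k := fun k => by positivity
  have hδ0 : Filter.Tendsto δ Filter.atTop (nhds 0) := tendsto_one_div_add_atTop_nhds_zero_nat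
  have hlim : Filter.Tendsto (fun k => (∫ z : Fin n → ℂ, fluxDensity (δ k) z) +
      2 * n * (∫ p in E \ F, f p) - (2 * n + 2 / η ^ 2) * m * δ k) Filter.atTop
      (nhds (2 * (∫ z : Fin n → ℂ, areaDensity z) + 2 * n * ∫ p in E \ F, f p)) := by
    simpa using ((tendsto_integral_fluxDensity hn hδ hδ0).add_const
      (2 * n * (∫ p in E \ F, f p))).sub (hδ0.const_mul ((2 * n + 2 / η ^ 2) * m))
  refine le_of_tendsto (ENNReal.tendsto_ofReal hlim) ?_
  filter_upwards [hδ0.eventually_lt_const (half_pos hp0), hδ0.eventually_lt_const hη] with k h1 h2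
  refine (ENNReal.ofReal_le_ofReal (hbound (δ k) (hδ k) h1 h2)).trans ?_
  exact le_iSup₂_of_le (calibration c η R (δ k))
    (calibration_mem_testFields hη (by linarith) (hδ k)) le_rfl

/-- The quantitative comparison for a curvature defect that is at least `q` times the `d`-th power
of the depth. -/
lemma perimeter_add_le (hn : 1 ≤ n) {F : Set (Heisenberg n)} (hF : NullMeasurableSet F)
    (hvol : volume F = volume (pansuSet n)) {ε : ℝ} (hc : 0 ≤ profile (1 - ε))
    (hcomp : CompactlyContained (symmDiff F (pansuSet n)) (halfCylinder n ε)) {q : ℝ} (hq : 0 ≤ q)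
    (d : ℕ)
    (hgap : ∀ P t : ℝ, profile (1 - ε) < t → t < P → P ≤ 2 →
      q * (P - t) ^ d ≤ 1 - 1 / √(1 + leafParam (profile (1 - ε)) P t)) :
    perimeter (pansuSet n) + ENNReal.ofReal (2 * n * q /
        ((d + 1) * unitBallVolume (2 * n) ^ d * 2 ^ (d + 1))) *
      volume (symmDiff F (pansuSet n)) ^ (d + 1) ≤ perimeter F := by
  have hE := (isOpen_pansuSet (n := n)).measurableSet
  have hω := unitBallVolume_pos (2 * n)
  have hEF : NullMeasurableSet (pansuSet n \ F) := hE.nullMeasurableSet.diff hF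
  have hEfin := volume_pansuSet_ne_top (n := n)
  have hEFfin : volume (pansuSet n \ F) ≠ ⊤ := measure_ne_top_of_subset Set.sdiff_subset hEfin
  have hm : volume (F \ pansuSet n) = volume (pansuSet n \ F) := by
    have h1 := measure_inter_add_sdiff₀ (μ := volume) F hE.nullMeasurableSet
    have h2 := measure_inter_add_sdiff₀ (μ := volume) (pansuSet n) hF
    rw [hvol, ← h2, Set.inter_comm (pansuSet n) F] at h1
    have hfin : volume (F ∩ pansuSet n) ≠ ⊤ :=
      measure_ne_top_of_subset Set.inter_subset_right hEfin
    exact (ENNReal.add_right_inj hfin).1 h1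
  -- Both halves of the symmetric difference have the same volume; this doubling produces the factor
  -- 2 ^ (d + 1) in the constant.
  have hsymm : volume (symmDiff F (pansuSet n)) =
      ENNReal.ofReal (2 * volume.real (pansuSet n \ F)) := by
    have h1 : volume (symmDiff F (pansuSet n)) =
        volume (F \ pansuSet n) + volume (pansuSet n \ F) :=
      measure_union₀ hEF (disjoint_sdiff_sdiff.aedisjoint)
    rw [h1, hm, ← two_mul, ENNReal.ofReal_mul two_pos.le, measureReal_def,
      ENNReal.ofReal_toReal hEFfin]
    simp
  have hlow := le_perimeter_of_gap hn hF hvol hc hcomp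
    (f := fun p => q * (sqProfile (sqNorm p.1) - p.2) ^ d)
    ((continuous_depth_pow d).const_mul q)
    (fun p h1 h2 => hgap _ _ h1 h2 (sqProfile_le_two (sqNorm_nonneg _)))
  have hbath := bathtub hn d hEF Set.sdiff_subset
  have hA : 0 ≤ ∫ z : Fin n → ℂ, areaDensity z := integral_nonneg fun z => areaDensity_nonneg z
  have hm0 : 0 ≤ volume.real (pansuSet n \ F) := measureReal_nonneg
  rw [hsymm, ← ENNReal.ofReal_pow (by positivity), ← ENNReal.ofReal_mul (by positivity)]
  refine (add_le_add_left (perimeter_pansuSet_le hn) _).trans ?_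
  rw [← ENNReal.ofReal_add (by positivity) (by positivity)]
  refine (ENNReal.ofReal_le_ofReal ?_).trans hlow
  rw [integral_const_mul]
  have e : 2 * n * q / ((d + 1) * unitBallVolume (2 * n) ^ d * 2 ^ (d + 1)) *
      (2 * volume.real (pansuSet n \ F)) ^ (d + 1) = 2 * n * (q *
      (volume.real (pansuSet n \ F) ^ (d + 1) / ((d + 1) * unitBallVolume (2 * n) ^ d))) := by
    rw [mul_pow]
    field_simp
  rw [e]
  have := mul_le_mul_of_nonneg_left (mul_le_mul_of_nonneg_left hbath hq)
    (by positivity : (0 : ℝ) ≤ 2 * n)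
  linarith

end Heisenberg

end

/-! ### The two stability estimates -/

theorem theorem1p1 (n : ℕ) (hn : 1 ≤ n) :
    Heisenberg.perimeter (Heisenberg.pansuSet n) ≠ ⊤ ∧
    ∀ F : Set (Heisenberg n),
      MeasureTheory.NullMeasurableSet F MeasureTheory.volume →
      MeasureTheory.volume F = MeasureTheory.volume (Heisenberg.pansuSet n) →
      (Heisenberg.CompactlyContained (symmDiff F (Heisenberg.pansuSet n))
          (Heisenberg.halfCylinder n 0) →
        Heisenberg.perimeter (Heisenberg.pansuSet n) +
            ENNReal.ofReal ((n : ℝ) / (240 * Heisenberg.unitBallVolume (2 * n) ^ 2)) *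
              MeasureTheory.volume (symmDiff F (Heisenberg.pansuSet n)) ^ 3
          ≤ Heisenberg.perimeter F) ∧
      (∀ ε : ℝ, 0 < ε → ε < 1 →
        Heisenberg.CompactlyContained (symmDiff F (Heisenberg.pansuSet n))
          (Heisenberg.halfCylinder n ε) →
        Heisenberg.perimeter (Heisenberg.pansuSet n) +
            ENNReal.ofReal ((n : ℝ) * Real.sqrt ε / (16 * Heisenberg.unitBallVolume (2 * n))) *
              MeasureTheory.volume (symmDiff F (Heisenberg.pansuSet n)) ^ 2
          ≤ Heisenberg.perimeter F) := by
  have hω := Heisenberg.unitBallVolume_pos (2 * n)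
  refine ⟨ne_top_of_le_ne_top ENNReal.ofReal_ne_top (Heisenberg.perimeter_pansuSet_le hn),
    fun F hF hvol => ⟨fun hcomp => ?_, fun ε h0 h1 hcomp => ?_⟩⟩
  · have hc : 0 ≤ Heisenberg.profile (1 - 0) :=
      (Real.sqrt_nonneg _).trans (Heisenberg.sqrt_le_profile le_rfl zero_le_one)
    -- The constant is 2n · (1/20) / (3 · 2³ ω²) = n / (240 ω²).
    have h := Heisenberg.perimeter_add_le hn hF hvol hc hcomp (q := 1 / 20) (by norm_num) 2
      fun P t ht htP hP => Heisenberg.quadratic_gap hc ht htP hP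
    convert! h using 4
    push_cast
    field_simp
    norm_num
  · have hs := Heisenberg.sqrt_le_profile h0.le h1.le
    have hc : 0 ≤ Heisenberg.profile (1 - ε) := (Real.sqrt_nonneg _).trans hs
    have hε : 2 * Real.sqrt ε ^ 2 ≤ Heisenberg.profile (1 - ε) ^ 2 := by
      rw [Real.sq_sqrt h0.le]
      exact (Real.sqrt_le_left hc).1 hs
    -- The constant is 2n · (√ε / 4) / (2 · 2² ω) = n √ε / (16 ω).
    have h := Heisenberg.perimeter_add_le hn hF hvol hc hcomp (q := Real.sqrt ε / 4)
      (by positivity) 1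
      fun P t ht htP hP => Heisenberg.linear_gap hε hc ht htP hP
    convert! h using 4
    push_cast
    field_simp
    norm_num
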